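/- **Terms.** Fix a set of positive and a set of negative instructions; the positive ones include, for each $n\in\mathbb N$, a primitive integer $\overline n$. With positive variables $x$, negative variables $\alpha$, and $\kappa$ for either, consider (modulo $\alpha$-equivalence): values $V ::= V_+\mid t_-$; positive values $V_+ ::= x\mid (V,V')\mid\{V\}\mid k_+$; positive terms $t_+ ::= V_+\mid \mu\alpha.c$; negative terms $t_- ::= \alpha\mid\mu(\kappa,\kappa').c\mid\mu\{\kappa\}.c\mid\mu x.c\mid k_-$; commands $c ::= \langle t_+\mid t_-\rangle$, identified with $\langle t_-\mid t_+\rangle$. For terms that are not both values, $(t,u)$ denotes $\mu\alpha.\langle t\mid\mu\kappa.\langle u\mid\mu\kappa'.\langle(\kappa,\kappa')\mid\alpha\rangle\rangle\rangle$, and for a non-value $t$, $\{t\}$ denotes $\mu\alpha.\langle t\mid\mu\kappa.\langle\{\kappa\}\mid\alpha\rangle\rangle$; with this convention any term can be substituted for a variable of its polarity. Reduction of closed commands: $\langle\mu\alpha.c\mid t_-\rangle\to_\mu c[t_- /\alpha]$, $\langle V_+\mid\mu x.c\rangle\to_\mu c[V_+/x]$, $\langle\{V\}\mid\mu\{\kappa\}.c\rangle\to_\beta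 c[V/\kappa]$, $\langle(V,V')\mid\mu(\kappa,\kappa').c\rangle\to_\beta c[V/\kappa,V'/\kappa']$ (when polarities match). **Typing.** MAL formulas: $P::=X\mid A\otimes B\mid{\downarrow}A$ (positive), $N::=X^\bot\mid A\wp B\mid{\uparrow}A$ (negative), with the De Morgan negation $(\cdot)^\bot$ ($\wp$ is the par connective, dual to $\otimes$). In a context, positive variables have negative formulas and conversely. The rules, each with its contribution to $M(\pi)\in\mathbb N$ ($M(\pi)$ is the sum of the contributions in $\pi$), are: axiom $\vdash\kappa:A\mid\kappa:A^\bot$ (0); from $c:(\vdash\alpha:P,\Gamma)$ infer $\vdash\mu\alpha.c:P\mid\Gamma$ (0); from $c:(\vdash x:N,\Gamma)$ infer $\vdash\mu x.c:N\mid\Gamma$ (0); cut: from $\vdash t:A\mid\Gamma$ and $\vdash u:A^\bot\mid\Delta$ infer $\langle t\mid u\rangle:(\vdash\Gamma,\Delta)$ (0); from $\vdash V:A\mid\Gamma$ and $\vdash V':B\mid\Delta$ infer $\vdash(V,V'):A\otimes B\mid\Gamma,\Delta$ (0); from $c:(\vdash\kappa:A,\kappa':B,\Gamma)$ infer $\vdash\mu(\kappa,\kappa').c:A\wp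 B\mid\Gamma$ (1); from $\vdash V:A\mid\Gamma$ infer $\vdash\{V\}:{\downarrow}A\mid\Gamma$ (0); from $c:(\vdash\kappa:A,\Gamma)$ infer $\vdash\mu\{\kappa\}.c:{\uparrow}A\mid\Gamma$ (1); weakening: from $c:(\vdash\Gamma)$ infer $c:(\vdash\kappa:A,\Gamma)$ (0). Contexts $\Gamma,\Delta$ are disjoint. **Countdown machine.** Negative commands are $\langle t^\ominus\mid u\rangle$ with $t$ a closed term of any polarity and $u$ a closed positive one; a forcing command is one of the form $\langle t^\ominus\mid(u,k)\rangle$, $t,u$ of opposite polarities (here values or not), and it is identified with $\langle u^\ominus\mid(t,k)\rangle$; it is written $c\{k\}$ for $c=\langle t\mid u\rangle$. The machine steps are $c\{\overline n\}\to_\bullet c'\{\overline n\}$ if $c\to_\mu c'$, and $c\{\overline{n+1}\}\to_\bullet c'\{\overline n\}$ if $c\to_\beta c'$; $c\{\overline 0\}$ diverges if $c\to_\beta c'$. Fix a set $\bot\!\!\!\bot_\bullet$ of negative commands that is closed under anti-evaluation (if $c\to_\bullet c'$ and $c'\in\bot\!\!\!\bot_\bullet$ then $c\in\bot\!\!\!\bot_\bullet$)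 and under $\to_\mu$-evaluation (if $c\to_\mu c'$ and $c\{\overline n\}\in\bot\!\!\!\bot_\bullet$ then $c'\{\overline n\}\in\bot\!\!\!\bot_\bullet$). **Realizability.** Constructors are the simply-kinded higher-order terms over the kinds $\iota,o^+,o^-,\sigma\to\tau$, with $\mathbf 0,\mathbf s$, recursors, $\otimes,\wp ,\downarrow,\uparrow,\forall,\exists$ over all kinds ($\forall,\exists$ preserve polarity), dual variables and recursors, $\langle T=U\rangle A$, and a predicate $[\cdot]:\iota\to o^+$ with its dual; negation extends to them by De Morgan duality, with $(\langle T=U\rangle A)^\bot=\langle T=U\rangle A^\bot$. For a set $X$ of closed positive values let $X^\bot$ be the set of closed negative terms $u$ with $\langle u^\ominus\mid V\rangle\in\bot\!\!\!\bot_\bullet$ for all $V\in X$. Fix a positive propositional domain $\mathcal D$: a set of sets of closed positive values, closed under unions and intersections of non-empty families, containing $X\otimes Y=\{(V,V')\mid V\in X,V'\in Y\}$ and ${\downarrow}X=\{\{V\}\mid V\in X\}$ for all $X,Y$ that are elements of $\mathcal D$ or orthogonals of such, and containing $\{\overline n\mid n\ge p\}$ for every $p\in\mathbb N$. Fix a total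 valuation $\rho$. Kinds are interpreted by $|\iota|=\mathbb N$, $|o^+|=\mathcal D$, $|o^-|=\{X^\bot\mid X\in\mathcal D\}$ (an element being given together with $X$), $|\sigma\to\tau|=|\tau|^{|\sigma|}$. Constructors are interpreted in the standard way, with $|A\otimes B|=|A|\otimes|B|$, $|{\downarrow}A|={\downarrow}|A|$, $\exists$ and $\forall$ on positive formulas as union and intersection, $|N|=|N^\bot|^\bot$ for negative $N$, $|[p]|=\{\overline n\mid n\ge p\}$, and, for positive $A$, $|\langle T=U\rangle A|_\rho=|A|_\rho$ if $|T|_\rho=|U|_\rho$ and $\emptyset$ otherwise. A closed term $t$ of any polarity *realizes* a negative formula $N$ if $\langle t^\ominus\mid V\rangle\in\bot\!\!\!\bot_\bullet$ for all $V\in|N^\bot|_\rho$. **Forcing.** Conditions are of kind $\iota$, with $+$ the addition defined by recursion; $\underline n$ is the numeral of $n$. For $Z:\iota\to o^{\pm}$ let $\overline Z=\lambda r.\forall r'.\,Z(r')^\bot\wp [r+r']^\bot$. Each MAL variable $X$ is associated with a variable $X$ of kind $\iota\to o^+$, and $X^*=X$, $(X^\bot)^*=\overline X$, $(A\otimes B)^*=\lambda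 r.\exists p_1.\exists p_2.\langle r=p_1+p_2\rangle(A^*(p_1)\otimes B^*(p_2))$, $(A\wp B)^*=\overline{(A^\bot\otimes B^\bot)^*}$, $({\downarrow}A)^*=\lambda r.{\downarrow}A^*(r)$, $({\uparrow}A)^*=\overline{({\downarrow}A^\bot)^*}$. The negative formula $p\Vdash_f A$ is $\overline{\overline{A^*}}(p)$ if $A$ is positive and $A^*(p)$ if $A$ is negative. **Theorem (adequacy of linear forcing).** Let $\pi$ be a derivation of $\vdash t:A\mid\kappa_1:B_1,\dots,\kappa_n:B_n$ in MAL. Let $u_1,\dots,u_n$ be closed terms (values or not), $u_i$ of the polarity of $\kappa_i$, and let $q_1,\dots,q_n\in\mathbb N$ be such that each $u_i$ realizes $\underline{q_i}\Vdash_f B_i^\bot$. Then $t[u_1/\kappa_1,\dots,u_n/\kappa_n]$ realizes $\underline{M(\pi)}+\underline{q_1}+\dots+\underline{q_n}\Vdash_f A$. -/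

import Mathlib

namespace LinForcing

universe w

/-! ## Term syntax -/

/-- Polarities. -/
inductive Pol : Type
  | pos
  | neg

/-- The opposite polarity. -/
@[reducible] def Pol.flip : Pol → Pol
  | .pos => .neg
  | .neg => .pos

theorem Pol.flip_flip : ∀ s : Pol, s.flip.flip = s
  | .pos => rfl
  | .neg => rfl

/-- Variables, as typed de Bruijn indices: a scope is the list of the polarities of the variables
in it, so that terms are taken modulo renaming of bound variables. -/
inductive Var : List Pol → Pol → Type
  | zero {Δ : List Pol} {s : Pol} : Var (s :: Δ) s
  | succ {Δ : List Pol} {s s' : Pol} (x : Var Δ s) : Var (s' :: Δ) s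

/-- Extension of a family indexed by the variables of a scope by a value at the new variable. -/
def Var.cons {F : Pol → Type w} {Δ : List Pol} {s : Pol} (a : F s) (f : ∀ s', Var Δ s' → F s') :
    ∀ s', Var (s :: Δ) s' → F s'
  | _, .zero => a
  | s', .succ x => f s' x

/- Syntax over a set `K pos` of positive and a set `K neg` of negative instructions, besides
the primitive integers. All the negative terms are values. -/
mutual

/-- Values `V`, of either polarity. -/
inductive Val (K : Pol → Type w) : List Pol → Pol → Type w
  /-- a variable -/
  | var {Δ : List Pol} {s : Pol} (x : Var Δ s) : Val K Δ s
  /-- an instruction -/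
  | instr {Δ : List Pol} {s : Pol} (k : K s) : Val K Δ s
  /-- the positive instruction that is the primitive integer `n` -/
  | num {Δ : List Pol} (n : ℕ) : Val K Δ .pos
  /-- `(V, V')` -/
  | pair {Δ : List Pol} {s s' : Pol} (V : Val K Δ s) (V' : Val K Δ s') : Val K Δ .pos
  /-- `{V}` -/
  | shift {Δ : List Pol} {s : Pol} (V : Val K Δ s) : Val K Δ .pos
  /-- `μ x. c` -/
  | mu {Δ : List Pol} (c : Cmd K (.pos :: Δ)) : Val K Δ .neg
  /-- `μ (κ, κ'). c` -/
  | muPair {Δ : List Pol} {s s' : Pol} (c : Cmd K (s :: s' :: Δ)) : Val K Δ .neg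
  /-- `μ {κ}. c` -/
  | muShift {Δ : List Pol} {s : Pol} (c : Cmd K (s :: Δ)) : Val K Δ .neg

/-- Terms, of either polarity. -/
inductive Tm (K : Pol → Type w) : List Pol → Pol → Type w
  | val {Δ : List Pol} {s : Pol} (V : Val K Δ s) : Tm K Δ s
  /-- `μ α. c` -/
  | mu {Δ : List Pol} (c : Cmd K (.neg :: Δ)) : Tm K Δ .pos

/-- Commands `⟨t | u⟩`; the identification of `⟨t | u⟩` with `⟨u | t⟩` is built in by always
writing the positive term first. -/
inductive Cmd (K : Pol → Type w) : List Pol → Type w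
  | cut {Δ : List Pol} (t : Tm K Δ .pos) (u : Tm K Δ .neg) : Cmd K Δ

end

/-- Action of a renaming under a binder. -/
def Var.liftRen {Δ Δ' : List Pol} {s : Pol} (r : ∀ s', Var Δ s' → Var Δ' s') :
    ∀ s', Var (s :: Δ) s' → Var (s :: Δ') s' :=
  Var.cons (F := Var (s :: Δ')) .zero (fun s' x => .succ (r s' x))

mutual

/-- Renaming of variables. -/
def Val.rename {K : Pol → Type w} {Δ Δ' : List Pol} (r : ∀ s, Var Δ s → Var Δ' s) :
    ∀ {s : Pol}, Val K Δ s → Val K Δ' s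
  | _, .var x => .var (r _ x)
  | _, .instr k => .instr k
  | _, .num n => .num n
  | _, .pair V V' => .pair (V.rename r) (V'.rename r)
  | _, .shift V => .shift (V.rename r)
  | _, .mu c => .mu (c.rename (Var.liftRen r))
  | _, .muPair c => .muPair (c.rename (Var.liftRen (Var.liftRen r)))
  | _, .muShift c => .muShift (c.rename (Var.liftRen r))

/-- Renaming of variables. -/
def Tm.rename {K : Pol → Type w} {Δ Δ' : List Pol} (r : ∀ s, Var Δ s → Var Δ' s) :
    ∀ {s : Pol}, Tm K Δ s → Tm K Δ' s
  | _, .val V => .val (V.rename r)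
  | _, .mu c => .mu (c.rename (Var.liftRen r))

/-- Renaming of variables. -/
def Cmd.rename {K : Pol → Type w} {Δ Δ' : List Pol} (r : ∀ s, Var Δ s → Var Δ' s) :
    Cmd K Δ → Cmd K Δ'
  | .cut t u => .cut (t.rename r) (u.rename r)

end

/-- Weakening of a value by one more variable in the scope. -/
def Val.weaken {K : Pol → Type w} {Δ : List Pol} {s s' : Pol} (V : Val K Δ s) :
    Val K (s' :: Δ) s :=
  V.rename (fun _ x => .succ x)

/-- Weakening of a term by one more variable in the scope. -/
def Tm.weaken {K : Pol → Type w} {Δ : List Pol} {s s' : Pol} (t : Tm K Δ s) :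
    Tm K (s' :: Δ) s :=
  t.rename (fun _ x => .succ x)

/-- Action of a substitution by values under a binder. -/
def Val.liftSub {K : Pol → Type w} {Δ Δ' : List Pol} {s : Pol}
    (f : ∀ s', Var Δ s' → Val K Δ' s') : ∀ s', Var (s :: Δ) s' → Val K (s :: Δ') s' :=
  Var.cons (F := Val K (s :: Δ')) (.var .zero) (fun s' x => (f s' x).weaken)

mutual

/-- Simultaneous capture-avoiding substitution of values for variables of the same polarity. -/
def Val.vsubst {K : Pol → Type w} {Δ Δ' : List Pol} (f : ∀ s, Var Δ s → Val K Δ' s) :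
    ∀ {s : Pol}, Val K Δ s → Val K Δ' s
  | _, .var x => f _ x
  | _, .instr k => .instr k
  | _, .num n => .num n
  | _, .pair V V' => .pair (V.vsubst f) (V'.vsubst f)
  | _, .shift V => .shift (V.vsubst f)
  | _, .mu c => .mu (c.vsubst (Val.liftSub f))
  | _, .muPair c => .muPair (c.vsubst (Val.liftSub (Val.liftSub f)))
  | _, .muShift c => .muShift (c.vsubst (Val.liftSub f))

/-- Simultaneous capture-avoiding substitution of values for variables of the same polarity. -/
def Tm.vsubst {K : Pol → Type w} {Δ Δ' : List Pol} (f : ∀ s, Var Δ s → Val K Δ' s) :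
    ∀ {s : Pol}, Tm K Δ s → Tm K Δ' s
  | _, .val V => .val (V.vsubst f)
  | _, .mu c => .mu (c.vsubst (Val.liftSub f))

/-- Simultaneous capture-avoiding substitution of values for variables of the same polarity. -/
def Cmd.vsubst {K : Pol → Type w} {Δ Δ' : List Pol} (f : ∀ s, Var Δ s → Val K Δ' s) :
    Cmd K Δ → Cmd K Δ'
  | .cut t u => .cut (t.vsubst f) (u.vsubst f)

end

/-- `c[V / κ]`, where `κ` is the last variable of the scope. -/
def Cmd.inst {K : Pol → Type w} {Δ : List Pol} {s : Pol} (c : Cmd K (s :: Δ)) (V : Val K Δ s) :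
    Cmd K Δ :=
  c.vsubst (Var.cons (F := Val K Δ) V (fun _ x => .var x))

/-- `c[V / κ, V' / κ']`, where `κ`, `κ'` are the last two variables of the scope. -/
def Cmd.inst₂ {K : Pol → Type w} {Δ : List Pol} {s s' : Pol} (c : Cmd K (s :: s' :: Δ))
    (V : Val K Δ s) (V' : Val K Δ s') : Cmd K Δ :=
  c.vsubst (Var.cons (F := Val K Δ) V (Var.cons (F := Val K Δ) V' (fun _ x => .var x)))

/-! ### Substitution of arbitrary terms

A term that is not a value may be substituted as well, with the usual definition of the pair and
of the one-tuple of terms that are not values. -/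

/-- `⟨t | μ κ. c⟩`, with `κ` of the polarity of `t`. -/
def Cmd.bind {K : Pol → Type w} {Δ : List Pol} : ∀ {s : Pol}, Tm K Δ s → Cmd K (s :: Δ) → Cmd K Δ
  | .pos, t, c => .cut t (.val (.mu c))
  | .neg, t, c => .cut (.mu c) t

/-- The pair of two terms: the value `(t, u)` if `t` and `u` are values, and otherwise
`μ α. ⟨t | μ κ. ⟨u | μ κ'. ⟨(κ, κ') | α⟩⟩⟩`. -/
def Tm.pair {K : Pol → Type w} {Δ : List Pol} {s s' : Pol} : Tm K Δ s → Tm K Δ s' → Tm K Δ .pos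
  | .val V, .val V' => .val (.pair V V')
  | t, u => .mu (.bind t.weaken (.bind u.weaken.weaken
      (.cut (.val (.pair (.var (.succ .zero)) (.var .zero)))
        (.val (.var (.succ (.succ .zero)))))))

/-- The one-tuple of a term: the value `{t}` if `t` is a value, and otherwise
`μ α. ⟨t | μ κ. ⟨{κ} | α⟩⟩`. -/
def Tm.shift {K : Pol → Type w} {Δ : List Pol} {s : Pol} : Tm K Δ s → Tm K Δ .pos
  | .val V => .val (.shift V)
  | t => .mu (.bind t.weaken
      (.cut (.val (.shift (.var .zero))) (.val (.var (.succ .zero)))))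

/-- Action of a substitution under a binder. -/
def Tm.liftSub {K : Pol → Type w} {Δ Δ' : List Pol} {s : Pol}
    (f : ∀ s', Var Δ s' → Tm K Δ' s') : ∀ s', Var (s :: Δ) s' → Tm K (s :: Δ') s' :=
  Var.cons (F := Tm K (s :: Δ')) (.val (.var .zero)) (fun s' x => (f s' x).weaken)

mutual

/-- Simultaneous capture-avoiding substitution of terms for variables of the same polarity. -/
def Val.subst {K : Pol → Type w} {Δ Δ' : List Pol} (f : ∀ s, Var Δ s → Tm K Δ' s) :
    ∀ {s : Pol}, Val K Δ s → Tm K Δ' s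
  | _, .var x => f _ x
  | _, .instr k => .val (.instr k)
  | _, .num n => .val (.num n)
  | _, .pair V V' => .pair (V.subst f) (V'.subst f)
  | _, .shift V => .shift (V.subst f)
  | _, .mu c => .val (.mu (c.subst (Tm.liftSub f)))
  | _, .muPair c => .val (.muPair (c.subst (Tm.liftSub (Tm.liftSub f))))
  | _, .muShift c => .val (.muShift (c.subst (Tm.liftSub f)))

/-- Simultaneous capture-avoiding substitution of terms for variables of the same polarity. -/
def Tm.subst {K : Pol → Type w} {Δ Δ' : List Pol} (f : ∀ s, Var Δ s → Tm K Δ' s) :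
    ∀ {s : Pol}, Tm K Δ s → Tm K Δ' s
  | _, .val V => V.subst f
  | _, .mu c => .mu (c.subst (Tm.liftSub f))

/-- Simultaneous capture-avoiding substitution of terms for variables of the same polarity. -/
def Cmd.subst {K : Pol → Type w} {Δ Δ' : List Pol} (f : ∀ s, Var Δ s → Tm K Δ' s) :
    Cmd K Δ → Cmd K Δ'
  | .cut t u => .cut (t.subst f) (u.subst f)

end

/-! ## Reduction and the countdown machine -/

/-- The administrative reduction steps. -/
inductive MuStep {K : Pol → Type w} : Cmd K [] → Cmd K [] → Prop
  | pos (c : Cmd K [.neg]) (t : Val K [] .neg) : MuStep (.cut (.mu c) (.val t)) (c.inst t)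
  | neg (V : Val K [] .pos) (c : Cmd K [.pos]) : MuStep (.cut (.val V) (.val (.mu c))) (c.inst V)

/-- The proper reduction steps (the polarities of the variables and of the values match). -/
inductive BetaStep {K : Pol → Type w} : Cmd K [] → Cmd K [] → Prop
  | shift {s : Pol} (V : Val K [] s) (c : Cmd K [s]) :
      BetaStep (.cut (.val (.shift V)) (.val (.muShift c))) (c.inst V)
  | pair {s s' : Pol} (V : Val K [] s) (V' : Val K [] s') (c : Cmd K [s, s']) :
      BetaStep (.cut (.val (.pair V V')) (.val (.muPair c))) (c.inst₂ V V')

/-- Negative commands `⟨t⊖ | u⟩`, with `t` of any polarity and `u` positive, modulo the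
identification of the forcing commands `⟨t⊖ | (u, k)⟩` and `⟨u⊖ | (t, k)⟩`, for `t`, `u` of opposite
polarities. A class of forcing commands is thus given by a command `c`, made of `t` and `u`, and
by `k`: it is `forcing c k`. The other negative commands are `plain`; see `negCmd`. -/
inductive NegCmd (K : Pol → Type w) : Type w
  | forcing {s : Pol} (c : Cmd K []) (k : Tm K [] s) : NegCmd K
  | plain {s : Pol} (t : Tm K [] s) (u : Tm K [] .pos) : NegCmd K

/-- The negative command `⟨t⊖ | u⟩`. It is a forcing command when `u` is a pair whose first
component has the polarity opposite to that of `t`. -/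
def negCmd {K : Pol → Type w} : ∀ {s : Pol}, Tm K [] s → Tm K [] .pos → NegCmd K
  | .neg, t, .val (@Val.pair _ _ .pos _ V k) => .forcing (.cut (.val V) t) (.val k)
  | .pos, t, .val (@Val.pair _ _ .neg _ V k) => .forcing (.cut t (.val V)) (.val k)
  | _, t, u => .plain t u

/-- The forcing command `c{n}`, whose counter is the primitive integer `n`. -/
def Cmd.count {K : Pol → Type w} (c : Cmd K []) (n : ℕ) : NegCmd K :=
  .forcing c (.val (.num n))

/-- The evaluation relation of the countdown machine. -/
inductive Step {K : Pol → Type w} : NegCmd K → NegCmd K → Prop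
  | mu {c c' : Cmd K []} (n : ℕ) (h : MuStep c c') : Step (c.count n) (c'.count n)
  | beta {c c' : Cmd K []} (n : ℕ) (h : BetaStep c c') : Step (c.count (n + 1)) (c'.count n)
  /-- divergence when the counter is zero -/
  | diverge {c c' : Cmd K []} (h : BetaStep c c') : Step (c.count 0) (c.count 0)

/-! ## Kinds and constructors -/

/-- Kinds: individuals, positive and negative formulas, functions. -/
inductive Kind : Type
  | iota
  | o (s : Pol)
  | arr (σ τ : Kind)

/-- Negation of kinds. -/
@[reducible] def Kind.dual : Kind → Kind
  | .iota => .iota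
  | .o s => .o s.flip
  | .arr σ τ => .arr σ τ.dual

theorem Kind.dual_dual : ∀ τ : Kind, τ.dual.dual = τ
  | .iota => rfl
  | .o s => congrArg Kind.o s.flip_flip
  | .arr σ τ => congrArg (Kind.arr σ) τ.dual_dual

/-- The kind of the recursor. -/
abbrev Kind.recK (τ ν : Kind) : Kind :=
  .arr τ (.arr (.arr .iota (.arr τ τ)) (.arr .iota ν))

/-- Well-kinded constructors, with countably many variables of each kind. Besides the constructors
of higher-order multiplicative affine logic there are the equational implication `⟨T = U⟩ A` and
the predicate `[·]` on conditions, with its dual. -/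
inductive Con : Kind → Type
  | var (τ : Kind) (x : ℕ) : Con τ
  | dvar (τ : Kind) (x : ℕ) : Con τ.dual
  | lam (σ : Kind) (x : ℕ) {τ : Kind} (T : Con τ) : Con (.arr σ τ)
  | app {σ τ : Kind} (T : Con (.arr σ τ)) (U : Con σ) : Con τ
  | zero : Con .iota
  | succ : Con (.arr .iota .iota)
  | recur (τ : Kind) : Con (.recK τ τ)
  | drecur (τ : Kind) : Con (.recK τ τ.dual)
  | tensor {s s' : Pol} (A : Con (.o s)) (B : Con (.o s')) : Con (.o .pos)
  | par {s s' : Pol} (A : Con (.o s)) (B : Con (.o s')) : Con (.o .neg)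
  | ex (σ : Kind) (x : ℕ) {s : Pol} (A : Con (.o s)) : Con (.o s)
  | all (σ : Kind) (x : ℕ) {s : Pol} (A : Con (.o s)) : Con (.o s)
  | down {s : Pol} (A : Con (.o s)) : Con (.o .pos)
  | up {s : Pol} (A : Con (.o s)) : Con (.o .neg)
  | eqImp {σ : Kind} (T U : Con σ) {s : Pol} (A : Con (.o s)) : Con (.o s)
  | cint : Con (.arr .iota (.o .pos))
  | dcint : Con (.arr .iota (.o .neg))

/-- Involutive negation of constructors. -/
def Con.perp : ∀ {τ : Kind}, Con τ → Con τ.dual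
  | _, .var τ x => .dvar τ x
  | _, .dvar τ x => cast (congrArg Con τ.dual_dual.symm) (.var τ x)
  | _, .lam σ x T => .lam σ x T.perp
  | _, .app T U => .app T.perp U
  | _, .zero => .zero
  | _, .succ => .succ
  | _, .recur τ => .drecur τ
  | _, .drecur τ => cast (congrArg (fun ν => Con (.recK τ ν)) τ.dual_dual.symm) (.recur τ)
  | _, .tensor A B => .par A.perp B.perp
  | _, .par A B => .tensor A.perp B.perp
  | _, .ex σ x A => .all σ x A.perp
  | _, .all σ x A => .ex σ x A.perp
  | _, .down A => .up A.perp
  | _, .up A => .down A.perp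
  | _, .eqImp T U A => .eqImp T U A.perp
  | _, .cint => .dcint
  | _, .dcint => .cint

/-- The call-by-name linear implication `A ⊸ B`, that is, the par of the negation of `A` with
`B`. -/
def Con.limp {s s' : Pol} (A : Con (.o s)) (B : Con (.o s')) : Con (.o .neg) :=
  .par (s := s.flip) A.perp B

/-- Addition on individuals, `λ p. λ q. rec p (λ z. s) q`. -/
def Con.plus : Con (.arr .iota (.arr .iota .iota)) :=
  .lam .iota 0 (.lam .iota 1
    (.app (.app (.app (.recur .iota) (.var .iota 0)) (.lam .iota 2 .succ)) (.var .iota 1)))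

/-- `p + q`. -/
def Con.add (p q : Con .iota) : Con .iota := .app (.app .plus p) q

/-- The numeral of `n`. -/
def Con.numeral : ℕ → Con .iota
  | 0 => .zero
  | n + 1 => .app .succ (.numeral n)

/-! ## The realizability model of the countdown machine -/

section Model

variable {K : Pol → Type w} (bot : Set (NegCmd K))

/-- The orthogonal, for the pole `{⟨t | u⟩ : ⟨u⊖ | t⟩ ∈ bot}`, of a set of closed positive
values. -/
def orth (X : Set (Val K [] .pos)) : Set (Val K [] .neg) :=
  {u | ∀ V ∈ X, negCmd (.val u) (.val V) ∈ bot}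

/-- The set `X ⊗ Y`. -/
def tensorSet {s s' : Pol} (X : Set (Val K [] s)) (Y : Set (Val K [] s')) :
    Set (Val K [] .pos) :=
  {V | ∃ V₁ ∈ X, ∃ V₂ ∈ Y, V = .pair V₁ V₂}

/-- The set `↓ X`. -/
def downSet {s : Pol} (X : Set (Val K [] s)) : Set (Val K [] .pos) :=
  {V | ∃ V₁ ∈ X, V = .shift V₁}

/-- The set of the primitive integers that are at least `p`. -/
def cintSet (K : Pol → Type w) (p : ℕ) : Set (Val K [] .pos) :=
  {V | ∃ n : ℕ, p ≤ n ∧ V = .num n}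

/-- `X` belongs to the domain `D` (if `s` is positive), resp. it is the orthogonal of an element of
`D` (if `s` is negative). -/
def InDom (D : Set (Set (Val K [] .pos))) : ∀ {s : Pol}, Set (Val K [] s) → Prop
  | .pos, X => X ∈ D
  | .neg, X => ∃ Y ∈ D, X = orth bot Y

/-- Positive propositional domains that contain the interpretation of the predicate `[·]`. -/
structure PropDomain where
  carrier : Set (Set (Val K [] .pos))
  sUnion_mem : ∀ S ⊆ carrier, S.Nonempty → ⋃₀ S ∈ carrier
  sInter_mem : ∀ S ⊆ carrier, S.Nonempty → ⋂₀ S ∈ carrier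
  tensor_mem : ∀ {s s' : Pol} (X : Set (Val K [] s)) (Y : Set (Val K [] s')),
    InDom bot carrier X → InDom bot carrier Y → tensorSet X Y ∈ carrier
  down_mem : ∀ {s : Pol} (X : Set (Val K [] s)), InDom bot carrier X → downSet X ∈ carrier
  cint_mem : ∀ p : ℕ, cintSet K p ∈ carrier

variable {bot}

theorem PropDomain.empty_mem (D : PropDomain bot) : (∅ : Set (Val K [] .pos)) ∈ D.carrier := by
  have h := D.sInter_mem (Set.range (cintSet K))
    (by rintro _ ⟨p, rfl⟩; exact D.cint_mem p) ⟨_, ⟨0, rfl⟩⟩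
  have e : ⋂₀ Set.range (cintSet K) = ∅ := by
    ext V
    constructor
    · intro hV
      obtain ⟨n, -, rfl⟩ := hV _ ⟨0, rfl⟩
      obtain ⟨m, hm, e⟩ := hV _ ⟨n + 1, rfl⟩
      cases e
      omega
    · intro hV
      exact hV.elim
  rwa [e] at h

/-- The interpretation of kinds. An element of the domain of negative formulas, which is the
orthogonal of some `X` in the positive domain, is represented by `X` itself. -/
@[reducible] def Kind.interp (D : PropDomain bot) : Kind → Type w
  | .iota => ULift ℕ
  | .o _ => {X : Set (Val K [] .pos) // X ∈ D.carrier}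
  | .arr σ τ => σ.interp D → τ.interp D

/-- The set of closed values of polarity `s` that an element of the interpretation of the kind of
formulas of polarity `s` stands for: `X` itself if `s` is positive, its orthogonal if `s` is
negative. -/
def Kind.toSet {D : PropDomain bot} : ∀ (s : Pol), (Kind.o s).interp D → Set (Val K [] s)
  | .pos, X => X.1
  | .neg, X => orth bot X.1

/-- The set of the negation of a formula: the orthogonal of `X` for a positive formula with
interpretation `X`, and `X` for a negative formula whose interpretation is the orthogonal
of `X`. -/
def Kind.toDualSet {D : PropDomain bot} : ∀ (s : Pol), (Kind.o s).interp D → Set (Val K [] s.flip)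
  | .pos, X => orth bot X.1
  | .neg, X => X.1

theorem Kind.inDom_toSet {D : PropDomain bot} :
    ∀ (s : Pol) (X : (Kind.o s).interp D), InDom bot D.carrier (Kind.toSet s X)
  | .pos, X => X.2
  | .neg, X => ⟨X.1, X.2, rfl⟩

theorem Kind.inDom_toDualSet {D : PropDomain bot} :
    ∀ (s : Pol) (X : (Kind.o s).interp D), InDom bot D.carrier (Kind.toDualSet s X)
  | .pos, X => ⟨X.1, X.2, rfl⟩
  | .neg, X => X.2

/-- Extended orthogonality on the elements of all kinds. It exchanges `X` and its orthogonal, so on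
representatives it is the identity. -/
def Kind.orthK {D : PropDomain bot} : ∀ τ : Kind, τ.interp D → τ.dual.interp D
  | .iota, n => n
  | .o _, X => X
  | .arr _ τ, f => fun v => τ.orthK (f v)

theorem Kind.interp_nonempty (D : PropDomain bot) : ∀ τ : Kind, Nonempty (τ.interp D)
  | .iota => ⟨⟨0⟩⟩
  | .o _ => ⟨⟨∅, D.empty_mem⟩⟩
  | .arr _ τ => (Kind.interp_nonempty D τ).map fun v _ => v

/-- Union of a family of elements of the domain, indexed by the interpretation of a kind. -/
def PropDomain.union (D : PropDomain bot) (σ : Kind)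
    (f : σ.interp D → {X : Set (Val K [] .pos) // X ∈ D.carrier}) :
    {X : Set (Val K [] .pos) // X ∈ D.carrier} :=
  ⟨⋃ v, (f v).1, by
    have := Kind.interp_nonempty D σ
    exact D.sUnion_mem _ (by rintro _ ⟨v, rfl⟩; exact (f v).2) (Set.range_nonempty _)⟩

/-- Intersection of a family of elements of the domain, indexed by the interpretation of a
kind. -/
def PropDomain.inter (D : PropDomain bot) (σ : Kind)
    (f : σ.interp D → {X : Set (Val K [] .pos) // X ∈ D.carrier}) :
    {X : Set (Val K [] .pos) // X ∈ D.carrier} :=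
  ⟨⋂ v, (f v).1, by
    have := Kind.interp_nonempty D σ
    exact D.sInter_mem _ (by rintro _ ⟨v, rfl⟩; exact (f v).2) (Set.range_nonempty _)⟩

/-- Total valuations. -/
abbrev Valuation (D : PropDomain bot) : Type w := ∀ τ : Kind, ℕ → τ.interp D

open Classical in
/-- Rebinding of a variable in a valuation. -/
noncomputable def Valuation.update {D : PropDomain bot} (ρ : Valuation D) (σ : Kind) (x : ℕ)
    (v : σ.interp D) : Valuation D :=
  fun τ y => if h : σ = τ ∧ x = y then h.1 ▸ v else ρ τ y

open Classical in
/-- The interpretation of constructors. A negative formula is represented by the interpretation of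
its negation (a set of positive values), of which its own interpretation is the orthogonal; the
latter is obtained by `Kind.toSet`. -/
noncomputable def Con.eval {D : PropDomain bot} : ∀ {τ : Kind}, Con τ → Valuation D → τ.interp D
  | _, .var τ x, ρ => ρ τ x
  | _, .dvar τ x, ρ => τ.orthK (ρ τ x)
  | _, .lam σ x T, ρ => fun v => T.eval (ρ.update σ x v)
  | _, .app T U, ρ => (T.eval ρ) (U.eval ρ)
  | _, .zero, _ => (⟨0⟩ : ULift ℕ)
  | _, .succ, _ => fun n : ULift ℕ => (⟨n.down + 1⟩ : ULift ℕ)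
  | _, .recur τ, _ => fun (a : τ.interp D) (f : ULift ℕ → τ.interp D → τ.interp D)
      (n : ULift ℕ) => Nat.rec (motive := fun _ => τ.interp D) a (fun m b => f ⟨m⟩ b) n.down
  | _, .drecur τ, _ => fun (a : τ.interp D) (f : ULift ℕ → τ.interp D → τ.interp D)
      (n : ULift ℕ) =>
        τ.orthK (Nat.rec (motive := fun _ => τ.interp D) a (fun m b => f ⟨m⟩ b) n.down)
  | _, .tensor (s := s) (s' := s') A B, ρ =>
      ⟨tensorSet (Kind.toSet s (A.eval ρ)) (Kind.toSet s' (B.eval ρ)),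
        D.tensor_mem _ _ (Kind.inDom_toSet s _) (Kind.inDom_toSet s' _)⟩
  | _, .par (s := s) (s' := s') A B, ρ =>
      ⟨tensorSet (Kind.toDualSet s (A.eval ρ)) (Kind.toDualSet s' (B.eval ρ)),
        D.tensor_mem _ _ (Kind.inDom_toDualSet s _) (Kind.inDom_toDualSet s' _)⟩
  | _, .ex (s := .pos) σ x A, ρ => D.union σ fun v => A.eval (ρ.update σ x v)
  | _, .ex (s := .neg) σ x A, ρ => D.inter σ fun v => A.eval (ρ.update σ x v)
  | _, .all (s := .pos) σ x A, ρ => D.inter σ fun v => A.eval (ρ.update σ x v)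
  | _, .all (s := .neg) σ x A, ρ => D.union σ fun v => A.eval (ρ.update σ x v)
  | _, .down (s := s) A, ρ =>
      ⟨downSet (Kind.toSet s (A.eval ρ)), D.down_mem _ (Kind.inDom_toSet s _)⟩
  | _, .up (s := s) A, ρ =>
      ⟨downSet (Kind.toDualSet s (A.eval ρ)), D.down_mem _ (Kind.inDom_toDualSet s _)⟩
  | _, .eqImp T U A, ρ => if T.eval ρ = U.eval ρ then A.eval ρ else ⟨∅, D.empty_mem⟩
  | _, .cint, _ => fun p : ULift ℕ => ⟨cintSet K p.down, D.cint_mem p.down⟩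
  | _, .dcint, _ => fun p : ULift ℕ => ⟨cintSet K p.down, D.cint_mem p.down⟩

/-- Realizability of a negative formula `N` by a closed term `t` of any polarity:
`⟨t⊖ | V⟩` is in the pole for all `V` in the interpretation of the negation of `N`. -/
def Realizes {D : PropDomain bot} (ρ : Valuation D) {s : Pol} (t : Tm K [] s)
    (N : Con (.o .neg)) : Prop :=
  ∀ V ∈ Kind.toDualSet .neg (N.eval ρ), negCmd t (.val V) ∈ bot

end Model

/-! ## Multiplicative affine logic -/

/-- Formulas of multiplicative affine logic, by polarity. -/
inductive Mal : Pol → Type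
  | atom (X : ℕ) : Mal .pos
  | datom (X : ℕ) : Mal .neg
  | tensor {s s' : Pol} (A : Mal s) (B : Mal s') : Mal .pos
  | par {s s' : Pol} (A : Mal s) (B : Mal s') : Mal .neg
  | down {s : Pol} (A : Mal s) : Mal .pos
  | up {s : Pol} (A : Mal s) : Mal .neg

/-- Negation of formulas. -/
def Mal.perp : ∀ {s : Pol}, Mal s → Mal s.flip
  | _, .atom X => .datom X
  | _, .datom X => .atom X
  | _, .tensor A B => .par A.perp B.perp
  | _, .par A B => .tensor A.perp B.perp
  | _, .down A => .up A.perp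
  | _, .up A => .down A.perp

/-- The negation of a positive formula, as a negative formula. -/
def Mal.perpPos (P : Mal .pos) : Mal .neg := P.perp

/-- The number of connectives of a formula. -/
def Mal.size : ∀ {s : Pol}, Mal s → ℕ
  | _, .atom _ => 0
  | _, .datom _ => 0
  | _, .tensor A B => A.size + B.size + 1
  | _, .par A B => A.size + B.size + 1
  | _, .down A => A.size + 1
  | _, .up A => A.size + 1

theorem Mal.size_perp : ∀ {s : Pol} (A : Mal s), A.perp.size = A.size
  | _, .atom _ => rfl
  | _, .datom _ => rfl
  | _, .tensor A B => by simp [Mal.perp, Mal.size, A.size_perp, B.size_perp]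
  | _, .par A B => by simp [Mal.perp, Mal.size, A.size_perp, B.size_perp]
  | _, .down A => by simp [Mal.perp, Mal.size, A.size_perp]
  | _, .up A => by simp [Mal.perp, Mal.size, A.size_perp]

/-- Typing contexts: a partial assignment of formulas to the variables in scope. A positive variable
has a negative formula and conversely. -/
abbrev Ctx (Δ : List Pol) : Type := ∀ s : Pol, Var Δ s → Option (Mal s.flip)

/-- The context `κ : A, Γ` with `κ` the new variable. -/
def Ctx.cons {Δ : List Pol} {s : Pol} (A : Mal s.flip) (Γ : Ctx Δ) : Ctx (s :: Δ) :=
  Var.cons (F := fun s' => Option (Mal s'.flip)) (some A) Γ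

/-- The context `α : P, Γ` with `α` the new variable, which is negative. -/
def Ctx.consNeg {Δ : List Pol} (P : Mal .pos) (Γ : Ctx Δ) : Ctx (.neg :: Δ) :=
  Ctx.cons (s := .neg) P Γ

/-- The context `x : N, Γ` with `x` the new variable, which is positive. -/
def Ctx.consPos {Δ : List Pol} (N : Mal .neg) (Γ : Ctx Δ) : Ctx (.pos :: Δ) :=
  Ctx.cons (s := .pos) N Γ

/-- `Γ` is the context that consists of `x : A` only. -/
def Ctx.IsSingle {Δ : List Pol} (Γ : Ctx Δ) {s : Pol} (x : Var Δ s) (A : Mal s.flip) : Prop :=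
  Γ s x = some A ∧ ∀ (s' : Pol) (y : Var Δ s'), ¬ (s' = s ∧ y ≍ x) → Γ s' y = none

/-- `Γ` is the union of `Γ₁` and `Γ₂`, which have disjoint domains. -/
def Ctx.Split {Δ : List Pol} (Γ Γ₁ Γ₂ : Ctx Δ) : Prop :=
  ∀ (s : Pol) (x : Var Δ s),
    (Γ₁ s x = Γ s x ∧ Γ₂ s x = none) ∨ (Γ₁ s x = none ∧ Γ₂ s x = Γ s x)

/-- `Γ'` is the context `x : A, Γ`, where `Γ` has no declaration of `x`. -/
def Ctx.IsInsert {Δ : List Pol} (Γ' Γ : Ctx Δ) {s : Pol} (x : Var Δ s) (A : Mal s.flip) : Prop :=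
  Γ s x = none ∧ Γ' s x = some A ∧
    ∀ (s' : Pol) (y : Var Δ s'), ¬ (s' = s ∧ y ≍ x) → Γ' s' y = Γ s' y

mutual

/-- Derivations of `⊢ t : A | Γ`. -/
inductive DTm {K : Pol → Type w} : ∀ {Δ : List Pol}, Ctx Δ → ∀ {s : Pol}, Tm K Δ s → Mal s → Type w
  | ax {Δ : List Pol} {Γ : Ctx Δ} {s : Pol} (x : Var Δ s) (A : Mal s)
      (hΓ : Γ.IsSingle x A.perp) : DTm Γ (.val (.var x)) A
  | muPos {Δ : List Pol} {Γ : Ctx Δ} {c : Cmd K (.neg :: Δ)} {P : Mal .pos}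
      (d : DCmd (Ctx.consNeg P Γ) c) : DTm Γ (.mu c) P
  | muNeg {Δ : List Pol} {Γ : Ctx Δ} {c : Cmd K (.pos :: Δ)} {N : Mal .neg}
      (d : DCmd (Ctx.consPos N Γ) c) : DTm Γ (.val (.mu c)) N
  | tensor {Δ : List Pol} {Γ Γ₁ Γ₂ : Ctx Δ} {s s' : Pol} {V : Val K Δ s} {V' : Val K Δ s'}
      {A : Mal s} {B : Mal s'} (d₁ : DTm Γ₁ (.val V) A) (d₂ : DTm Γ₂ (.val V') B)
      (hΓ : Γ.Split Γ₁ Γ₂) : DTm Γ (.val (.pair V V')) (.tensor A B)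
  | par {Δ : List Pol} {Γ : Ctx Δ} {s s' : Pol} {c : Cmd K (s :: s' :: Δ)}
      {A : Mal s.flip} {B : Mal s'.flip} (d : DCmd (Ctx.cons A (Ctx.cons B Γ)) c) :
      DTm Γ (.val (.muPair c)) (.par A B)
  | down {Δ : List Pol} {Γ : Ctx Δ} {s : Pol} {V : Val K Δ s} {A : Mal s}
      (d : DTm Γ (.val V) A) : DTm Γ (.val (.shift V)) (.down A)
  | up {Δ : List Pol} {Γ : Ctx Δ} {s : Pol} {c : Cmd K (s :: Δ)} {A : Mal s.flip}
      (d : DCmd (Ctx.cons A Γ) c) : DTm Γ (.val (.muShift c)) (.up A)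

/-- Derivations of `c : (⊢ Γ)`. -/
inductive DCmd {K : Pol → Type w} : ∀ {Δ : List Pol}, Ctx Δ → Cmd K Δ → Type w
  | cut {Δ : List Pol} {Γ Γ₁ Γ₂ : Ctx Δ} {t : Tm K Δ .pos} {u : Tm K Δ .neg} {P : Mal .pos}
      (d₁ : DTm Γ₁ t P) (d₂ : DTm Γ₂ u P.perpPos) (hΓ : Γ.Split Γ₁ Γ₂) : DCmd Γ (.cut t u)
  | weak {Δ : List Pol} {Γ Γ' : Ctx Δ} {c : Cmd K Δ} {s : Pol} (x : Var Δ s) (A : Mal s.flip)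
      (d : DCmd Γ c) (hΓ : Γ'.IsInsert Γ x A) : DCmd Γ' c

end

mutual

/-- The quantity `M(π)` of a derivation `π`, in the additive monoid of natural numbers where a
proper reduction step costs `1`. -/
def DTm.cost {K : Pol → Type w} : ∀ {Δ : List Pol} {Γ : Ctx Δ} {s : Pol} {t : Tm K Δ s} {A : Mal s},
    DTm Γ t A → ℕ
  | _, _, _, _, _, .ax _ _ _ => 0
  | _, _, _, _, _, .muPos d => d.cost
  | _, _, _, _, _, .muNeg d => d.cost
  | _, _, _, _, _, .tensor d₁ d₂ _ => d₁.cost + d₂.cost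
  | _, _, _, _, _, .par d => d.cost + 1
  | _, _, _, _, _, .down d => d.cost
  | _, _, _, _, _, .up d => d.cost + 1

/-- The quantity `M(π)` of a derivation `π` of a command. -/
def DCmd.cost {K : Pol → Type w} : ∀ {Δ : List Pol} {Γ : Ctx Δ} {c : Cmd K Δ}, DCmd Γ c → ℕ
  | _, _, _, .cut d₁ d₂ _ => d₁.cost + d₂.cost
  | _, _, _, .weak _ _ d _ => d.cost

end

/-! ## Linear forcing -/

/-- The forcing orthogonal `λ r. ∀ r'. Z(r') ⊸ [r + r']⊥` of a predicate `Z` on conditions without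
free variables of kind `ι`. -/
def forcingOrth {s : Pol} (Z : Con (.arr .iota (.o s))) : Con (.arr .iota (.o .neg)) :=
  .lam .iota 0 (.all .iota 1
    (.limp (.app Z (.var .iota 1)) (.app .dcint (.add (.var .iota 0) (.var .iota 1)))))

/-- `λ r. ∃ p₁. ∃ p₂. ⟨r = p₁ + p₂⟩ (Y(p₁) ⊗ Z(p₂))`, for `Y`, `Z` without free variables of kind
`ι`. -/
def forcingTensor {s s' : Pol} (Y : Con (.arr .iota (.o s))) (Z : Con (.arr .iota (.o s'))) :
    Con (.arr .iota (.o .pos)) :=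
  .lam .iota 0 (.ex .iota 1 (.ex .iota 2
    (.eqImp (.var .iota 0) (.add (.var .iota 1) (.var .iota 2))
      (.tensor (.app Y (.var .iota 1)) (.app Z (.var .iota 2))))))

/-- `λ r. ↓ Z(r)`, for `Z` without free variables of kind `ι`. -/
def forcingDown {s : Pol} (Z : Con (.arr .iota (.o s))) : Con (.arr .iota (.o .pos)) :=
  .lam .iota 0 (.down (.app Z (.var .iota 0)))

/-- The forcing translation `A*`, a predicate on conditions. Each propositional variable `X` is
associated with the variable `X` of kind `ι → o⁺`; no variable of kind `ι` is free in `A*`. -/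
def Mal.star : ∀ {s : Pol}, Mal s → Con (.arr .iota (.o s))
  | _, .atom X => .var (.arr .iota (.o .pos)) X
  | _, .datom X => forcingOrth (.var (.arr .iota (.o .pos)) X)
  | _, .tensor A B => forcingTensor A.star B.star
  | _, .par A B => forcingOrth (forcingTensor A.perp.star B.perp.star)
  | _, .down A => forcingDown A.star
  | _, .up A => forcingOrth (forcingDown A.perp.star)
termination_by s A => A.size
decreasing_by all_goals (simp only [Mal.size, Mal.size_perp]; omega)

/-- The formula `p ⊩ A` (`p` forces `A`), which is always negative. -/
def forces (p : Con .iota) : ∀ {s : Pol}, Mal s → Con (.o .neg)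
  | .pos, P => .app (forcingOrth (forcingOrth P.star)) p
  | .neg, N => .app N.star p

/-- The condition `p + q₁ + ⋯ + qₙ`, with a numeral `qᵢ` for each of the variables of a scope. -/
def sumCond (p : Con .iota) : ∀ (Δ : List Pol), (∀ s : Pol, Var Δ s → ℕ) → Con .iota
  | [], _ => p
  | s :: Δ, q => sumCond (.add p (.numeral (q s .zero))) Δ (fun s' x => q s' (.succ x))

end LinForcing

open LinForcing

namespace LinForcing

universe w

variable {K : Pol → Type w}

theorem Var.cons_ext {F : Pol → Type w} {Δ : List Pol} {s : Pol} {f g : ∀ s', Var (s :: Δ) s' → F s'}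
    (h₀ : f s .zero = g s .zero) (h : ∀ s' (x : Var Δ s'), f s' x.succ = g s' x.succ) : f = g := by
  funext s' x
  cases x with
  | zero => exact h₀
  | succ x => exact h _ x

theorem Var.liftRen_comp {Δ Δ' Δ'' : List Pol} {s : Pol} (r : ∀ s, Var Δ s → Var Δ' s)
    (r' : ∀ s, Var Δ' s → Var Δ'' s) :
    (fun s' x => Var.liftRen (s := s) r' s' (Var.liftRen r s' x)) =
      Var.liftRen (fun s x => r' s (r s x)) :=
  Var.cons_ext rfl fun _ _ => rfl

mutual

theorem Val.rename_rename : ∀ {Δ : List Pol} {s : Pol} (V : Val K Δ s) {Δ' Δ'' : List Pol}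
    (r : ∀ s, Var Δ s → Var Δ' s) (r' : ∀ s, Var Δ' s → Var Δ'' s),
    (V.rename r).rename r' = V.rename (fun s x => r' s (r s x))
  | _, _, .var x, _, _, r, r' => by simp [Val.rename]
  | _, _, .instr k, _, _, r, r' => by simp [Val.rename]
  | _, _, .num n, _, _, r, r' => by simp [Val.rename]
  | _, _, .pair V V', _, _, r, r' => by
    simp [Val.rename, Val.rename_rename V, Val.rename_rename V']
  | _, _, .shift V, _, _, r, r' => by simp [Val.rename, Val.rename_rename V]
  | _, _, .mu c, _, _, r, r' => by simp [Val.rename, Cmd.rename_rename c, Var.liftRen_comp]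
  | _, _, .muPair c, _, _, r, r' => by simp [Val.rename, Cmd.rename_rename c, Var.liftRen_comp]
  | _, _, .muShift c, _, _, r, r' => by simp [Val.rename, Cmd.rename_rename c, Var.liftRen_comp]

theorem Tm.rename_rename : ∀ {Δ : List Pol} {s : Pol} (t : Tm K Δ s) {Δ' Δ'' : List Pol}
    (r : ∀ s, Var Δ s → Var Δ' s) (r' : ∀ s, Var Δ' s → Var Δ'' s),
    (t.rename r).rename r' = t.rename (fun s x => r' s (r s x))
  | _, _, .val V, _, _, r, r' => by simp [Tm.rename, Val.rename_rename V]
  | _, _, .mu c, _, _, r, r' => by simp [Tm.rename, Cmd.rename_rename c, Var.liftRen_comp]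

theorem Cmd.rename_rename : ∀ {Δ : List Pol} (c : Cmd K Δ) {Δ' Δ'' : List Pol}
    (r : ∀ s, Var Δ s → Var Δ' s) (r' : ∀ s, Var Δ' s → Var Δ'' s),
    (c.rename r).rename r' = c.rename (fun s x => r' s (r s x))
  | _, .cut t u, _, _, r, r' => by
    simp [Cmd.rename, Tm.rename_rename t, Tm.rename_rename u]

end

theorem Val.liftSub_liftRen {Δ Δ' Δ'' : List Pol} {s : Pol} (r : ∀ s, Var Δ s → Var Δ' s)
    (f : ∀ s, Var Δ' s → Val K Δ'' s) :
    (fun s' x => Val.liftSub (s := s) f s' (Var.liftRen r s' x)) =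
      Val.liftSub (fun s x => f s (r s x)) :=
  Var.cons_ext rfl fun _ _ => rfl

mutual

theorem Val.vsubst_rename : ∀ {Δ : List Pol} {s : Pol} (V : Val K Δ s) {Δ' Δ'' : List Pol}
    (r : ∀ s, Var Δ s → Var Δ' s) (f : ∀ s, Var Δ' s → Val K Δ'' s),
    (V.rename r).vsubst f = V.vsubst (fun s x => f s (r s x))
  | _, _, .var x, _, _, r, f => by simp [Val.rename, Val.vsubst]
  | _, _, .instr k, _, _, r, f => by simp [Val.rename, Val.vsubst]
  | _, _, .num n, _, _, r, f => by simp [Val.rename, Val.vsubst]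
  | _, _, .pair V V', _, _, r, f => by
    simp [Val.rename, Val.vsubst, Val.vsubst_rename V, Val.vsubst_rename V']
  | _, _, .shift V, _, _, r, f => by simp [Val.rename, Val.vsubst, Val.vsubst_rename V]
  | _, _, .mu c, _, _, r, f => by
    simp [Val.rename, Val.vsubst, Cmd.vsubst_rename c, Val.liftSub_liftRen]
  | _, _, .muPair c, _, _, r, f => by
    simp [Val.rename, Val.vsubst, Cmd.vsubst_rename c, Val.liftSub_liftRen]
  | _, _, .muShift c, _, _, r, f => by
    simp [Val.rename, Val.vsubst, Cmd.vsubst_rename c, Val.liftSub_liftRen]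

theorem Tm.vsubst_rename : ∀ {Δ : List Pol} {s : Pol} (t : Tm K Δ s) {Δ' Δ'' : List Pol}
    (r : ∀ s, Var Δ s → Var Δ' s) (f : ∀ s, Var Δ' s → Val K Δ'' s),
    (t.rename r).vsubst f = t.vsubst (fun s x => f s (r s x))
  | _, _, .val V, _, _, r, f => by simp [Tm.rename, Tm.vsubst, Val.vsubst_rename V]
  | _, _, .mu c, _, _, r, f => by
    simp [Tm.rename, Tm.vsubst, Cmd.vsubst_rename c, Val.liftSub_liftRen]

theorem Cmd.vsubst_rename : ∀ {Δ : List Pol} (c : Cmd K Δ) {Δ' Δ'' : List Pol}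
    (r : ∀ s, Var Δ s → Var Δ' s) (f : ∀ s, Var Δ' s → Val K Δ'' s),
    (c.rename r).vsubst f = c.vsubst (fun s x => f s (r s x))
  | _, .cut t u, _, _, r, f => by
    simp [Cmd.rename, Cmd.vsubst, Tm.vsubst_rename t, Tm.vsubst_rename u]

end

theorem Val.rename_liftSub {Δ Δ' Δ'' : List Pol} {s : Pol} (f : ∀ s, Var Δ s → Val K Δ' s)
    (r : ∀ s, Var Δ' s → Var Δ'' s) :
    (fun s' x => (Val.liftSub (s := s) f s' x).rename (Var.liftRen r)) =
      Val.liftSub (fun s x => (f s x).rename r) := by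
  refine Var.cons_ext ?_ fun s' x => ?_
  · simp [Val.liftSub, Var.cons, Val.rename, Var.liftRen]
  · simp [Val.liftSub, Var.cons, Val.weaken, Val.rename_rename, Var.liftRen]

mutual

theorem Val.rename_vsubst : ∀ {Δ : List Pol} {s : Pol} (V : Val K Δ s) {Δ' Δ'' : List Pol}
    (f : ∀ s, Var Δ s → Val K Δ' s) (r : ∀ s, Var Δ' s → Var Δ'' s),
    (V.vsubst f).rename r = V.vsubst (fun s x => (f s x).rename r)
  | _, _, .var x, _, _, f, r => by simp [Val.vsubst]
  | _, _, .instr k, _, _, f, r => by simp [Val.rename, Val.vsubst]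
  | _, _, .num n, _, _, f, r => by simp [Val.rename, Val.vsubst]
  | _, _, .pair V V', _, _, f, r => by
    simp [Val.rename, Val.vsubst, Val.rename_vsubst V, Val.rename_vsubst V']
  | _, _, .shift V, _, _, f, r => by simp [Val.rename, Val.vsubst, Val.rename_vsubst V]
  | _, _, .mu c, _, _, f, r => by
    simp [Val.rename, Val.vsubst, Cmd.rename_vsubst c, Val.rename_liftSub]
  | _, _, .muPair c, _, _, f, r => by
    simp [Val.rename, Val.vsubst, Cmd.rename_vsubst c, Val.rename_liftSub]
  | _, _, .muShift c, _, _, f, r => by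
    simp [Val.rename, Val.vsubst, Cmd.rename_vsubst c, Val.rename_liftSub]

theorem Tm.rename_vsubst : ∀ {Δ : List Pol} {s : Pol} (t : Tm K Δ s) {Δ' Δ'' : List Pol}
    (f : ∀ s, Var Δ s → Val K Δ' s) (r : ∀ s, Var Δ' s → Var Δ'' s),
    (t.vsubst f).rename r = t.vsubst (fun s x => (f s x).rename r)
  | _, _, .val V, _, _, f, r => by simp [Tm.rename, Tm.vsubst, Val.rename_vsubst V]
  | _, _, .mu c, _, _, f, r => by
    simp [Tm.rename, Tm.vsubst, Cmd.rename_vsubst c, Val.rename_liftSub]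

theorem Cmd.rename_vsubst : ∀ {Δ : List Pol} (c : Cmd K Δ) {Δ' Δ'' : List Pol}
    (f : ∀ s, Var Δ s → Val K Δ' s) (r : ∀ s, Var Δ' s → Var Δ'' s),
    (c.vsubst f).rename r = c.vsubst (fun s x => (f s x).rename r)
  | _, .cut t u, _, _, f, r => by
    simp [Cmd.rename, Cmd.vsubst, Tm.rename_vsubst t, Tm.rename_vsubst u]

end

theorem Val.liftSub_var {Δ : List Pol} {s : Pol} :
    Val.liftSub (K := K) (s := s) (fun _ (x : Var Δ _) => .var x) = fun _ x => .var x := by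
  refine Var.cons_ext rfl fun s' x => ?_
  simp [Val.liftSub, Var.cons, Val.weaken, Val.rename]

mutual

theorem Val.vsubst_var : ∀ {Δ : List Pol} {s : Pol} (V : Val K Δ s),
    V.vsubst (fun _ x => .var x) = V
  | _, _, .var x => by simp [Val.vsubst]
  | _, _, .instr k => by simp [Val.vsubst]
  | _, _, .num n => by simp [Val.vsubst]
  | _, _, .pair V V' => by simp [Val.vsubst, Val.vsubst_var V, Val.vsubst_var V']
  | _, _, .shift V => by simp [Val.vsubst, Val.vsubst_var V]
  | _, _, .mu c => by simp [Val.vsubst, Val.liftSub_var, Cmd.vsubst_var c]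
  | _, _, .muPair c => by simp [Val.vsubst, Val.liftSub_var, Cmd.vsubst_var c]
  | _, _, .muShift c => by simp [Val.vsubst, Val.liftSub_var, Cmd.vsubst_var c]

theorem Tm.vsubst_var : ∀ {Δ : List Pol} {s : Pol} (t : Tm K Δ s),
    t.vsubst (fun _ x => .var x) = t
  | _, _, .val V => by simp [Tm.vsubst, Val.vsubst_var V]
  | _, _, .mu c => by simp [Tm.vsubst, Val.liftSub_var, Cmd.vsubst_var c]

theorem Cmd.vsubst_var : ∀ {Δ : List Pol} (c : Cmd K Δ), c.vsubst (fun _ x => .var x) = c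
  | _, .cut t u => by simp [Cmd.vsubst, Tm.vsubst_var t, Tm.vsubst_var u]

end

theorem Val.vsubst_weaken {Δ Δ' : List Pol} {s s' : Pol} (V : Val K Δ s) (W : Val K Δ' s')
    (f : ∀ s, Var Δ s → Val K Δ' s) :
    V.weaken.vsubst (Var.cons (F := Val K Δ') W f) = V.vsubst f := by
  simp only [Val.weaken, Val.vsubst_rename]; rfl

theorem Tm.vsubst_weaken {Δ Δ' : List Pol} {s s' : Pol} (t : Tm K Δ s) (W : Val K Δ' s')
    (f : ∀ s, Var Δ s → Val K Δ' s) :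
    t.weaken.vsubst (Var.cons (F := Val K Δ') W f) = t.vsubst f := by
  simp only [Tm.weaken, Tm.vsubst_rename]; rfl

theorem Tm.vsubst_liftSub_weaken {Δ Δ' : List Pol} {s s' : Pol} (t : Tm K Δ s)
    (f : ∀ s, Var Δ s → Val K Δ' s) :
    (t.weaken (s' := s')).vsubst (Val.liftSub f) = (t.vsubst f).weaken := by
  rw [Val.liftSub, Tm.vsubst_weaken, Tm.weaken, Tm.rename_vsubst]; rfl

theorem Cmd.vsubst_bind {Δ Δ' : List Pol} (f : ∀ s, Var Δ s → Val K Δ' s) :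
    ∀ {s : Pol} (t : Tm K Δ s) (c : Cmd K (s :: Δ)),
    (Cmd.bind t c).vsubst f = Cmd.bind (t.vsubst f) (c.vsubst (Val.liftSub f))
  | .pos, t, c => by simp [Cmd.bind, Cmd.vsubst, Tm.vsubst, Val.vsubst]
  | .neg, t, c => by simp [Cmd.bind, Cmd.vsubst, Tm.vsubst]

/-- The pair of two terms, evaluated from left to right even if they are values. -/
def Tm.letPair {Δ : List Pol} {s s' : Pol} (t : Tm K Δ s) (u : Tm K Δ s') : Tm K Δ .pos :=
  .mu (.bind t.weaken (.bind u.weaken.weaken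
    (.cut (.val (.pair (.var (.succ .zero)) (.var .zero))) (.val (.var (.succ (.succ .zero)))))))

/-- The one-tuple of a term, which is evaluated even if it is a value. -/
def Tm.letShift {Δ : List Pol} {s : Pol} (t : Tm K Δ s) : Tm K Δ .pos :=
  .mu (.bind t.weaken (.cut (.val (.shift (.var .zero))) (.val (.var (.succ .zero)))))

theorem Tm.vsubst_letPair {Δ Δ' : List Pol} (f : ∀ s, Var Δ s → Val K Δ' s) {s s' : Pol}
    (t : Tm K Δ s) (u : Tm K Δ s') :
    (Tm.letPair t u).vsubst f = .letPair (t.vsubst f) (u.vsubst f) := by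
  simp only [Tm.letPair, Tm.vsubst, Cmd.vsubst_bind, Tm.vsubst_liftSub_weaken, Cmd.vsubst,
    Val.vsubst]
  rfl

theorem Tm.vsubst_letShift {Δ Δ' : List Pol} (f : ∀ s, Var Δ s → Val K Δ' s) {s : Pol}
    (t : Tm K Δ s) : (Tm.letShift t).vsubst f = .letShift (t.vsubst f) := by
  simp only [Tm.letShift, Tm.vsubst, Cmd.vsubst_bind, Tm.vsubst_liftSub_weaken, Cmd.vsubst,
    Val.vsubst]
  rfl

theorem Tm.vsubst_pair {Δ Δ' : List Pol} (f : ∀ s, Var Δ s → Val K Δ' s) {s s' : Pol}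
    (t : Tm K Δ s) (u : Tm K Δ s') :
    (Tm.pair t u).vsubst f = .pair (t.vsubst f) (u.vsubst f) := by
  cases t with
  | val V =>
    cases u with
    | val V' => simp [Tm.pair, Tm.vsubst, Val.vsubst]
    | mu c => exact Tm.vsubst_letPair f (.val V) (.mu c)
  | mu c =>
    cases u with
    | val V' => exact Tm.vsubst_letPair f (.mu c) (.val V')
    | mu c' => exact Tm.vsubst_letPair f (.mu c) (.mu c')

theorem Tm.vsubst_shift {Δ Δ' : List Pol} (f : ∀ s, Var Δ s → Val K Δ' s) {s : Pol}
    (t : Tm K Δ s) : (Tm.shift t).vsubst f = .shift (t.vsubst f) := by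
  cases t with
  | val V => simp [Tm.shift, Tm.vsubst, Val.vsubst]
  | mu c => exact Tm.vsubst_letShift f (.mu c)

theorem Tm.vsubst_liftSub {Δ Δ' Δ'' : List Pol} {s : Pol} (f : ∀ s, Var Δ s → Tm K Δ' s)
    (g : ∀ s, Var Δ' s → Val K Δ'' s) :
    (fun s' x => (Tm.liftSub (s := s) f s' x).vsubst (Val.liftSub g)) =
      Tm.liftSub (fun s x => (f s x).vsubst g) := by
  refine Var.cons_ext ?_ fun s' x => ?_
  · simp [Tm.liftSub, Val.liftSub, Var.cons, Tm.vsubst, Val.vsubst]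
  · exact Tm.vsubst_liftSub_weaken _ _

mutual

theorem Val.vsubst_subst : ∀ {Δ : List Pol} {s : Pol} (V : Val K Δ s) {Δ' Δ'' : List Pol}
    (f : ∀ s, Var Δ s → Tm K Δ' s) (g : ∀ s, Var Δ' s → Val K Δ'' s),
    (V.subst f).vsubst g = V.subst (fun s x => (f s x).vsubst g)
  | _, _, .var x, _, _, f, g => by simp [Val.subst]
  | _, _, .instr k, _, _, f, g => by simp [Val.subst, Val.vsubst, Tm.vsubst]
  | _, _, .num n, _, _, f, g => by simp [Val.subst, Val.vsubst, Tm.vsubst]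
  | _, _, .pair V V', _, _, f, g => by
    simp [Val.subst, Tm.vsubst_pair, Val.vsubst_subst V, Val.vsubst_subst V']
  | _, _, .shift V, _, _, f, g => by simp [Val.subst, Tm.vsubst_shift, Val.vsubst_subst V]
  | _, _, .mu c, _, _, f, g => by
    simp [Val.subst, Val.vsubst, Tm.vsubst, Cmd.vsubst_subst c, Tm.vsubst_liftSub]
  | _, _, .muPair c, _, _, f, g => by
    simp [Val.subst, Val.vsubst, Tm.vsubst, Cmd.vsubst_subst c, Tm.vsubst_liftSub]
  | _, _, .muShift c, _, _, f, g => by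
    simp [Val.subst, Val.vsubst, Tm.vsubst, Cmd.vsubst_subst c, Tm.vsubst_liftSub]

theorem Tm.vsubst_subst : ∀ {Δ : List Pol} {s : Pol} (t : Tm K Δ s) {Δ' Δ'' : List Pol}
    (f : ∀ s, Var Δ s → Tm K Δ' s) (g : ∀ s, Var Δ' s → Val K Δ'' s),
    (t.subst f).vsubst g = t.subst (fun s x => (f s x).vsubst g)
  | _, _, .val V, _, _, f, g => by simp [Tm.subst, Val.vsubst_subst V]
  | _, _, .mu c, _, _, f, g => by
    simp [Tm.subst, Tm.vsubst, Cmd.vsubst_subst c, Tm.vsubst_liftSub]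

theorem Cmd.vsubst_subst : ∀ {Δ : List Pol} (c : Cmd K Δ) {Δ' Δ'' : List Pol}
    (f : ∀ s, Var Δ s → Tm K Δ' s) (g : ∀ s, Var Δ' s → Val K Δ'' s),
    (c.subst f).vsubst g = c.subst (fun s x => (f s x).vsubst g)
  | _, .cut t u, _, _, f, g => by
    simp [Cmd.subst, Cmd.vsubst, Tm.vsubst_subst t, Tm.vsubst_subst u]

end

theorem Cmd.inst_subst_liftSub {Δ Δ' : List Pol} {s : Pol} (c : Cmd K (s :: Δ))
    (f : ∀ s, Var Δ s → Tm K Δ' s) (V : Val K Δ' s) :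
    (c.subst (Tm.liftSub f)).inst V = c.subst (Var.cons (F := Tm K Δ') (.val V) f) := by
  rw [Cmd.inst, Cmd.vsubst_subst]
  congr 1
  refine Var.cons_ext ?_ fun s' x => ?_
  · simp [Tm.liftSub, Var.cons, Tm.vsubst, Val.vsubst]
  · simp [Tm.liftSub, Var.cons, Tm.vsubst_weaken, Tm.vsubst_var]

theorem Cmd.inst₂_subst_liftSub {Δ Δ' : List Pol} {s s' : Pol} (c : Cmd K (s :: s' :: Δ))
    (f : ∀ s, Var Δ s → Tm K Δ' s) (V : Val K Δ' s) (V' : Val K Δ' s') :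
    (c.subst (Tm.liftSub (Tm.liftSub f))).inst₂ V V' =
      c.subst (Var.cons (F := Tm K Δ') (.val V) (Var.cons (F := Tm K Δ') (.val V') f)) := by
  rw [Cmd.inst₂, Cmd.vsubst_subst]
  congr 1
  refine Var.cons_ext ?_ (fun s' x => ?_)
  · simp [Tm.liftSub, Var.cons, Tm.vsubst, Val.vsubst]
  · cases x with
    | zero => simp [Tm.liftSub, Var.cons, Tm.weaken, Tm.rename, Val.rename, Tm.vsubst, Val.vsubst]
    | succ x => simp [Tm.liftSub, Var.cons, Tm.vsubst_weaken, Tm.vsubst_var]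

variable {bot : Set (NegCmd K)} {D : PropDomain bot}

theorem Valuation.update_same (ρ : Valuation D) (σ : Kind) (x : ℕ) (v : σ.interp D) :
    ρ.update σ x v σ x = v := by
  simp [Valuation.update]

theorem Valuation.update_of_ne (ρ : Valuation D) (σ : Kind) (x : ℕ) (v : σ.interp D) {τ : Kind}
    {y : ℕ} (h : ¬ (σ = τ ∧ x = y)) : ρ.update σ x v τ y = ρ τ y := by
  simp [Valuation.update, h]

theorem Kind.orthK_orthK : ∀ (τ : Kind) (v : τ.interp D), τ.dual.orthK (τ.orthK v) ≍ v
  | .iota, _ => HEq.rfl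
  | .o _, _ => by simp only [Kind.orthK]; rfl
  | .arr σ τ, f => by
    have := fun v => Kind.orthK_orthK τ (f v)
    simp only [Kind.orthK]
    exact Function.hfunext rfl fun v v' h => by cases h; exact this v

theorem Con.eval_cast {τ τ' : Kind} (h : τ = τ') (T : Con τ) (ρ : Valuation D) :
    (cast (congrArg Con h) T).eval ρ ≍ T.eval ρ := by
  subst h; rfl

theorem Con.eval_perp : ∀ {τ : Kind} (T : Con τ) (ρ : Valuation D),
    T.perp.eval ρ = τ.orthK (T.eval ρ)
  | _, .var τ x, ρ => by simp [Con.perp, Con.eval]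
  | _, .dvar τ x, ρ => by
    simp only [Con.perp]
    refine eq_of_heq ((Con.eval_cast τ.dual_dual.symm _ ρ).trans ?_)
    simp only [Con.eval]
    exact (Kind.orthK_orthK τ _).symm
  | _, .lam σ x T, ρ => by
    have := T.eval_perp
    simp only [Con.perp, Con.eval, Kind.orthK, this]
  | _, .app T U, ρ => by
    simp only [Con.perp, Con.eval, Kind.orthK, T.eval_perp]
  | _, .zero, ρ => by simp [Con.perp, Con.eval, Kind.orthK]
  | _, .succ, ρ => by simp [Con.perp, Con.eval, Kind.orthK]
  | _, .recur τ, ρ => by simp [Con.perp, Con.eval, Kind.orthK]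
  | _, .drecur τ, ρ => by
    simp only [Con.perp]
    refine eq_of_heq
      ((Con.eval_cast (congrArg (Kind.recK τ) τ.dual_dual.symm) (.recur τ) ρ).trans ?_)
    simp only [Con.eval, Kind.orthK]
    refine Function.hfunext rfl fun a a' ha => ?_
    refine Function.hfunext rfl fun f f' hf => ?_
    refine Function.hfunext rfl fun n n' hn => ?_
    cases ha; cases hf; cases hn
    exact (Kind.orthK_orthK τ _).symm
  | _, .tensor (s := s) (s' := s') A B, ρ => by
    have hA := A.eval_perp ρ
    have hB := B.eval_perp ρ
    cases s <;> cases s' <;>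
    simp [Con.perp, Con.eval, Kind.orthK, hA, hB, Kind.toSet, Kind.toDualSet]
  | _, .par (s := s) (s' := s') A B, ρ => by
    have hA := A.eval_perp ρ
    have hB := B.eval_perp ρ
    cases s <;> cases s' <;>
    simp [Con.perp, Con.eval, Kind.orthK, hA, hB, Kind.toSet, Kind.toDualSet]
  | _, .ex σ x (s := s) A, ρ => by
    have hA := fun v => A.eval_perp (ρ.update σ x v)
    cases s <;> simp [Con.perp, Con.eval, Kind.orthK, hA]
  | _, .all σ x (s := s) A, ρ => by
    have hA := fun v => A.eval_perp (ρ.update σ x v)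
    cases s <;> simp [Con.perp, Con.eval, Kind.orthK, hA]
  | _, .down (s := s) A, ρ => by
    have hA := A.eval_perp ρ
    cases s <;> simp [Con.perp, Con.eval, Kind.orthK, hA, Kind.toSet, Kind.toDualSet]
  | _, .up (s := s) A, ρ => by
    have hA := A.eval_perp ρ
    cases s <;> simp [Con.perp, Con.eval, Kind.orthK, hA, Kind.toSet, Kind.toDualSet]
  | _, .eqImp T U A, ρ => by
    simp [Con.perp, Con.eval, Kind.orthK, A.eval_perp]
  | _, .cint, ρ => by simp [Con.perp, Con.eval, Kind.orthK]
  | _, .dcint, ρ => by simp [Con.perp, Con.eval, Kind.orthK]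

theorem Con.eval_add (p q : Con .iota) (ρ : Valuation D) :
    (Con.add p q).eval ρ = ⟨(p.eval ρ).down + (q.eval ρ).down⟩ := by
  simp only [Con.add, Con.plus, Con.eval, Valuation.update_same,
    Valuation.update_of_ne _ .iota 1 _ (τ := .iota) (y := 0) (by simp)]
  generalize (q.eval ρ).down = n
  generalize p.eval ρ = m
  induction n with
  | zero => rfl
  | succ n ih => simp only [ih]; rfl

theorem Con.eval_numeral (n : ℕ) (ρ : Valuation D) : (Con.numeral n).eval ρ = ⟨n⟩ := by
  induction n with
  | zero => simp [Con.numeral, Con.eval]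
  | succ n ih => simp [Con.numeral, Con.eval, ih]

/-- The sum of a family of natural numbers indexed by the variables of a scope. -/
def Var.sum : ∀ {Δ : List Pol}, (∀ s : Pol, Var Δ s → ℕ) → ℕ
  | [], _ => 0
  | _ :: _, q => q _ .zero + Var.sum fun s x => q s x.succ

theorem Var.le_sum {s : Pol} : ∀ {Δ : List Pol} (q : ∀ s : Pol, Var Δ s → ℕ) (x : Var Δ s),
    q s x ≤ Var.sum q
  | _ :: _, _, .zero => Nat.le_add_right _ _
  | _ :: _, q, .succ x => (Var.le_sum (fun s x => q s x.succ) x).trans (Nat.le_add_left _ _)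

theorem Var.sum_add_sum_le : ∀ {Δ : List Pol} {q₁ q₂ q : ∀ s : Pol, Var Δ s → ℕ}
    (_ : ∀ s x, q₁ s x + q₂ s x ≤ q s x), Var.sum q₁ + Var.sum q₂ ≤ Var.sum q
  | [], _, _, _, _ => le_rfl
  | s :: _, _, _, _, h => by
    have h₀ := h s .zero
    have h₁ := Var.sum_add_sum_le fun s x => h s (.succ x)
    simp only [Var.sum]
    omega

/-- The interpretation of `T` does not depend on the variables of kind `ι`. -/
def Con.IotaInvariant (D : PropDomain bot) {τ : Kind} (T : Con τ) : Prop :=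
  ∀ (ρ : Valuation D) (x : ℕ) (v : Kind.iota.interp D), T.eval (ρ.update .iota x v) = T.eval ρ

theorem Valuation.update_iota_of_ne (ρ : Valuation D) {x y : ℕ} (h : x ≠ y)
    (v : Kind.iota.interp D) : ρ.update .iota x v .iota y = ρ .iota y :=
  ρ.update_of_ne _ _ _ fun e => h e.2

theorem eval_forcingOrth {s : Pol} {Z : Con (.arr .iota (.o s))} (hZ : Z.IotaInvariant D)
    (ρ : Valuation D) (r : Kind.iota.interp D) :
    ((forcingOrth Z).eval ρ r).1 = {X | ∃ r' : ℕ, ∃ V ∈ Kind.toSet s (Z.eval ρ ⟨r'⟩),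
      ∃ n : ℕ, r.down + r' ≤ n ∧ X = .pair V (.num n)} := by
  have key : ∀ ρ : Valuation D, Kind.toDualSet s.flip ((Con.app Z (.var .iota 1)).perp.eval ρ) ≍
      Kind.toSet s (Z.eval ρ (ρ .iota 1)) := by
    intro ρ
    rw [Con.eval_perp]
    cases s <;> simp [Con.eval, Kind.toSet, Kind.toDualSet, Kind.orthK]
  ext X
  simp only [forcingOrth, Con.limp, Con.eval, PropDomain.union, Set.mem_iUnion, tensorSet,
    Set.mem_ofPred_eq, Con.eval_add, Valuation.update_same]
  cases s <;> have key := fun ρ => eq_of_heq (key ρ)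
  all_goals
    simp only [key, hZ _, Valuation.update_same, Valuation.update_iota_of_ne _ one_ne_zero]
    constructor
    · rintro ⟨r', V, hV, _, ⟨n, hn, rfl⟩, rfl⟩
      exact ⟨r'.down, V, hV, n, hn, rfl⟩
    · rintro ⟨r', V, hV, n, hn, rfl⟩
      exact ⟨⟨r'⟩, V, hV, _, ⟨n, hn, rfl⟩, rfl⟩

theorem eval_forcingTensor {s s' : Pol} {Y : Con (.arr .iota (.o s))}
    {Z : Con (.arr .iota (.o s'))} (hY : Y.IotaInvariant D) (hZ : Z.IotaInvariant D)
    (ρ : Valuation D) (r : Kind.iota.interp D) :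
    ((forcingTensor Y Z).eval ρ r).1 = {X | ∃ p₁ p₂ : ℕ, r.down = p₁ + p₂ ∧
      ∃ V ∈ Kind.toSet s (Y.eval ρ ⟨p₁⟩), ∃ V' ∈ Kind.toSet s' (Z.eval ρ ⟨p₂⟩),
        X = .pair V V'} := by
  ext X
  simp only [forcingTensor, Con.eval, PropDomain.union, Set.mem_iUnion, tensorSet,
    Set.mem_ofPred_eq, Con.eval_add, Valuation.update_same, hY _, hZ _]
  simp only [Valuation.update_same, Valuation.update_iota_of_ne _ one_ne_zero,
    Valuation.update_iota_of_ne _ two_ne_zero,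
    Valuation.update_iota_of_ne _ (show (2 : ℕ) ≠ 1 by decide)]
  constructor
  · rintro ⟨p₁, p₂, h⟩
    split_ifs at h with e
    · exact ⟨p₁.down, p₂.down, congrArg ULift.down e, h⟩
    · exact h.elim
  · rintro ⟨p₁, p₂, e, h⟩
    refine ⟨⟨p₁⟩, ⟨p₂⟩, ?_⟩
    rw [if_pos (ULift.ext _ _ e)]
    exact h

theorem eval_forcingDown {s : Pol} {Z : Con (.arr .iota (.o s))} (hZ : Z.IotaInvariant D)
    (ρ : Valuation D) (r : Kind.iota.interp D) :
    ((forcingDown Z).eval ρ r).1 = {X | ∃ V ∈ Kind.toSet s (Z.eval ρ r), X = .shift V} := by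
  simp only [forcingDown, Con.eval, downSet, Valuation.update_same, hZ _]

theorem iotaInvariant_forcingOrth {s : Pol} {Z : Con (.arr .iota (.o s))}
    (hZ : Z.IotaInvariant D) : (forcingOrth Z).IotaInvariant D := by
  intro ρ x v
  funext r
  refine Subtype.ext ?_
  rw [eval_forcingOrth hZ, eval_forcingOrth hZ, hZ]

theorem iotaInvariant_forcingTensor {s s' : Pol} {Y : Con (.arr .iota (.o s))}
    {Z : Con (.arr .iota (.o s'))} (hY : Y.IotaInvariant D) (hZ : Z.IotaInvariant D) :
    (forcingTensor Y Z).IotaInvariant D := by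
  intro ρ x v
  funext r
  refine Subtype.ext ?_
  rw [eval_forcingTensor hY hZ, eval_forcingTensor hY hZ, hY, hZ]

theorem iotaInvariant_forcingDown {s : Pol} {Z : Con (.arr .iota (.o s))}
    (hZ : Z.IotaInvariant D) : (forcingDown Z).IotaInvariant D := by
  intro ρ x v
  funext r
  refine Subtype.ext ?_
  rw [eval_forcingDown hZ, eval_forcingDown hZ, hZ]

theorem Mal.iotaInvariant_star : ∀ {s : Pol} (A : Mal s), A.star.IotaInvariant D
  | _, .atom X => by
    intro ρ x v
    simp [Mal.star, Con.eval, Valuation.update_of_ne]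
  | _, .datom X => by
    rw [Mal.star]
    refine iotaInvariant_forcingOrth fun ρ x v => ?_
    simp [Con.eval, Valuation.update_of_ne]
  | _, .tensor A B => by
    rw [Mal.star]
    exact iotaInvariant_forcingTensor A.iotaInvariant_star B.iotaInvariant_star
  | _, .par A B => by
    rw [Mal.star]
    exact iotaInvariant_forcingOrth
      (iotaInvariant_forcingTensor A.perp.iotaInvariant_star B.perp.iotaInvariant_star)
  | _, .down A => by
    rw [Mal.star]
    exact iotaInvariant_forcingDown A.iotaInvariant_star
  | _, .up A => by
    rw [Mal.star]
    exact iotaInvariant_forcingOrth (iotaInvariant_forcingDown A.perp.iotaInvariant_star)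
termination_by s A => A.size
decreasing_by all_goals (simp only [Mal.size, Mal.size_perp]; omega)

theorem Mal.perp_perp : ∀ {s : Pol} (A : Mal s), A.perp.perp ≍ A
  | _, .atom _ => HEq.rfl
  | _, .datom _ => HEq.rfl
  | _, .tensor (s := s) (s' := s') A B => by
    have hA := A.perp_perp
    have hB := B.perp_perp
    cases s <;> cases s' <;>
      exact heq_of_eq (congrArg₂ Mal.tensor (eq_of_heq hA) (eq_of_heq hB))
  | _, .par (s := s) (s' := s') A B => by
    have hA := A.perp_perp
    have hB := B.perp_perp
    cases s <;> cases s' <;> exact heq_of_eq (congrArg₂ Mal.par (eq_of_heq hA) (eq_of_heq hB))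
  | _, .down (s := s) A => by
    have hA := A.perp_perp
    cases s <;> exact heq_of_eq (congrArg Mal.down (eq_of_heq hA))
  | _, .up (s := s) A => by
    have hA := A.perp_perp
    cases s <;> exact heq_of_eq (congrArg Mal.up (eq_of_heq hA))

theorem Mal.star_neg (N : Mal .neg) : N.star = forcingOrth (Mal.star (s := .pos) N.perp) := by
  cases N with
  | datom X => simp [Mal.star, Mal.perp]
  | par A B => simp [Mal.star, Mal.perp]
  | up A => simp [Mal.star, Mal.perp]

theorem Mal.star_perp_pos (P : Mal .pos) : Mal.star (s := .neg) P.perp = forcingOrth P.star := by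
  have h : Mal.perp (s := .neg) P.perp = P := eq_of_heq P.perp_perp
  exact (Mal.star_neg P.perp).trans (by rw [h])

/-- The set of closed values that interprets `A*(p)`. -/
noncomputable def starSet (ρ : Valuation D) {s : Pol} (A : Mal s) (p : ℕ) : Set (Val K [] s) :=
  Kind.toSet s (A.star.eval ρ ⟨p⟩)

/-- The set of closed values that interprets `(B⊥)*(p)`. -/
noncomputable def dualStarSet (ρ : Valuation D) :
    ∀ {s : Pol}, Mal s.flip → ℕ → Set (Val K [] s)
  | .pos, B => starSet ρ (s := .pos) B.perp
  | .neg, B => starSet ρ (s := .neg) B.perp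

/-- The command `⟨t | V⟩`. -/
def Tm.against : ∀ {s : Pol}, Tm K [] s → Val K [] s.flip → Cmd K []
  | .pos, t, V => .cut t (.val V)
  | .neg, t, V => .cut (.val V) t

/-- The closed term `t` realizes `p ⊩ B⊥`, spelled out in terms of the values in `B*`. -/
def Passes (ρ : Valuation D) (p : ℕ) {s : Pol} (t : Tm K [] s) (B : Mal s.flip) : Prop :=
  ∀ r, ∀ V ∈ starSet ρ B r, ∀ n, p + r ≤ n → (t.against V).count n ∈ bot

theorem Passes.mono {ρ : Valuation D} {p q : ℕ} {s : Pol} {t : Tm K [] s} {B : Mal s.flip}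
    (h : Passes ρ p t B) (hpq : p ≤ q) : Passes ρ q t B :=
  fun r V hV n hn => h r V hV n (by omega)

theorem negCmd_pair_num {s : Pol} (t : Tm K [] s) (V : Val K [] s.flip) (n : ℕ) :
    negCmd t (.val (.pair V (.num n))) = (t.against V).count n := by
  cases s <;> rfl

theorem realizes_forcingOrth {s s' : Pol} {Z : Con (.arr .iota (.o s'))} (hZ : Z.IotaInvariant D)
    (ρ : Valuation D) (p : Con .iota) (t : Tm K [] s) :
    Realizes ρ t (.app (forcingOrth Z) p) ↔ ∀ r : ℕ, ∀ V ∈ Kind.toSet s' (Z.eval ρ ⟨r⟩), ∀ n : ℕ,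
      (p.eval ρ).down + r ≤ n → negCmd t (.val (.pair V (.num n))) ∈ bot := by
  have h := eval_forcingOrth hZ ρ (p.eval ρ)
  simp only [Realizes, Kind.toDualSet, Con.eval]
  rw [h]
  constructor
  · exact fun H r V hV n hn => H _ ⟨r, V, hV, n, hn, rfl⟩
  · rintro H _ ⟨r, V, hV, n, hn, rfl⟩
    exact H r V hV n hn

theorem realizes_forces (ρ : Valuation D) (p : Con .iota) :
    ∀ {s : Pol} (t : Tm K [] s) (A : Mal s),
    Realizes ρ t (forces p A) ↔ Passes ρ (p.eval ρ).down t A.perp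
  | .pos, t, A => by
    rw [forces, realizes_forcingOrth (iotaInvariant_forcingOrth A.iotaInvariant_star),
      ← Mal.star_perp_pos]
    simp only [← negCmd_pair_num, Passes, starSet]
  | .neg, t, A => by
    rw [forces, Mal.star_neg, realizes_forcingOrth (Mal.iotaInvariant_star _)]
    simp only [← negCmd_pair_num, Passes, starSet]

theorem realizes_forces_perp (ρ : Valuation D) (p : Con .iota) :
    ∀ {s : Pol} (t : Tm K [] s) (B : Mal s.flip),
    Realizes ρ t (forces p B.perp) ↔ Passes ρ (p.eval ρ).down t B
  | .pos, t, B => by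
    have h : Mal.perp (s := .pos) B.perp = B := eq_of_heq B.perp_perp
    exact (realizes_forces ρ p (s := .pos) t B.perp).trans (by rw [h])
  | .neg, t, B => by
    have h : Mal.perp (s := .neg) B.perp = B := eq_of_heq B.perp_perp
    exact (realizes_forces ρ p (s := .neg) t B.perp).trans (by rw [h])

theorem mem_starSet_neg (ρ : Valuation D) (N : Mal .neg) (p : ℕ) (W : Val K [] .neg) :
    W ∈ starSet ρ N p ↔ Passes ρ p (.val W) N.perp := by
  have h := eval_forcingOrth (D := D) (Mal.iotaInvariant_star (s := .pos) N.perp) ρ ⟨p⟩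
  simp only [starSet, Kind.toSet, orth]
  rw [Mal.star_neg, h]
  constructor
  · intro H r V hV n hn
    rw [← negCmd_pair_num]
    exact H _ ⟨r, V, hV, n, hn, rfl⟩
  · rintro H _ ⟨r, V, hV, n, hn, rfl⟩
    exact (negCmd_pair_num (.val W) V n).symm ▸ H r V hV n hn

theorem passes_of_mem_dualStarSet (ρ : Valuation D) : ∀ {s : Pol} (B : Mal s.flip) (p : ℕ)
    (V : Val K [] s), V ∈ dualStarSet ρ B p → Passes ρ p (.val V) B
  | .pos, B, p, V, hV => fun r W hW n hn =>
    (mem_starSet_neg ρ B r W).1 hW p V hV n (by omega)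
  | .neg, B, p, V, hV => by
    have h : Mal.perp (s := .neg) B.perp = B := eq_of_heq B.perp_perp
    have := (mem_starSet_neg ρ B.perp p V).1 hV
    rwa [h] at this

theorem mem_starSet_tensor (ρ : Valuation D) {s s' : Pol} (A : Mal s) (B : Mal s') (r : ℕ)
    (X : Val K [] .pos) : X ∈ starSet ρ (A.tensor B) r ↔ ∃ p₁ p₂ : ℕ, r = p₁ + p₂ ∧
      ∃ V ∈ starSet ρ A p₁, ∃ V' ∈ starSet ρ B p₂, X = .pair V V' := by
  have h := eval_forcingTensor (D := D) A.iotaInvariant_star B.iotaInvariant_star ρ ⟨r⟩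
  simp only [starSet, Kind.toSet, Mal.star]
  rw [h]
  rfl

theorem mem_starSet_down (ρ : Valuation D) {s : Pol} (A : Mal s) (r : ℕ)
    (X : Val K [] .pos) : X ∈ starSet ρ A.down r ↔ ∃ V ∈ starSet ρ A r, X = .shift V := by
  have h := eval_forcingDown (D := D) A.iotaInvariant_star ρ ⟨r⟩
  simp only [starSet, Kind.toSet, Mal.star]
  rw [h]
  rfl

theorem mem_starSet_par_perp (ρ : Valuation D) {s s' : Pol} (A : Mal s.flip) (B : Mal s'.flip)
    (r : ℕ) (X : Val K [] .pos) :
    X ∈ starSet ρ (s := .pos) (A.par B).perp r ↔ ∃ p₁ p₂ : ℕ, r = p₁ + p₂ ∧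
      ∃ V ∈ dualStarSet ρ A p₁, ∃ V' ∈ dualStarSet ρ B p₂, X = .pair V V' := by
  cases s <;> cases s' <;> exact mem_starSet_tensor ρ A.perp B.perp r X

theorem mem_starSet_up_perp (ρ : Valuation D) {s : Pol} (A : Mal s.flip)
    (r : ℕ) (X : Val K [] .pos) :
    X ∈ starSet ρ (s := .pos) A.up.perp r ↔ ∃ V ∈ dualStarSet ρ A r, X = .shift V := by
  cases s <;> exact mem_starSet_down ρ A.perp r X

theorem Con.eval_sumCond (ρ : Valuation D) : ∀ (Δ : List Pol) (p : Con .iota)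
    (q : ∀ s : Pol, Var Δ s → ℕ), ((sumCond p Δ q).eval ρ).down = (p.eval ρ).down + Var.sum q
  | [], _, _ => rfl
  | s :: Δ, p, q => by
    rw [sumCond, Con.eval_sumCond ρ Δ, Con.eval_add, Con.eval_numeral, Var.sum]
    exact Nat.add_assoc _ _ _

theorem count_bind_mem (h_anti : ∀ c c' : NegCmd K, Step c c' → c' ∈ bot → c ∈ bot)
    {ρ : Valuation D} {p r : ℕ} : ∀ {s : Pol} {t : Tm K [] s} {A : Mal s} {c : Cmd K [s]}
    (_ : Passes ρ p t A.perp)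
    (_ : ∀ p', ∀ V ∈ starSet ρ A p', ∀ n, p' + r ≤ n → (c.inst V).count n ∈ bot)
    {n : ℕ} (_ : p + r ≤ n), (Cmd.bind t c).count n ∈ bot
  | .pos, t, A, c, ht, hc, n, hn => by
    refine ht r (.mu c) ((mem_starSet_neg ρ A.perp r _).2 fun p' V hV m hm => ?_) n hn
    have h : Mal.perp (s := .neg) A.perp = A := eq_of_heq A.perp_perp
    rw [h] at hV
    exact h_anti _ _ (.mu m (.neg V c)) (hc p' V hV m (by omega))
  | .neg, .val V, A, c, ht, hc, n, hn =>
    h_anti _ _ (.mu n (.pos c V)) (hc p V ((mem_starSet_neg ρ A p V).2 ht) n hn)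

theorem count_inst_mem (h_anti : ∀ c c' : NegCmd K, Step c c' → c' ∈ bot → c ∈ bot)
    (h_mu : ∀ (c c' : Cmd K []) (n : ℕ), MuStep c c' → c.count n ∈ bot → c'.count n ∈ bot)
    {ρ : Valuation D} {p r : ℕ} : ∀ {s : Pol} {V : Val K [] s} {A : Mal s} {c : Cmd K [s]}
    (_ : Passes ρ p (.val V) A.perp)
    (_ : ∀ p', ∀ V ∈ starSet ρ A p', ∀ n, p' + r ≤ n → (c.inst V).count n ∈ bot)
    {n : ℕ} (_ : p + r ≤ n), (c.inst V).count n ∈ bot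
  | .pos, V, _, c, ht, hc, n, hn => h_mu _ _ n (.neg V c) (count_bind_mem h_anti ht hc hn)
  | .neg, V, _, c, ht, hc, n, hn => h_mu _ _ n (.pos c V) (count_bind_mem h_anti ht hc hn)

theorem Tm.inst_weaken {s s' : Pol} (t : Tm K [] s) (V : Val K [] s') :
    t.weaken.vsubst (Var.cons (F := Val K []) V (fun _ x => .var x)) = t := by
  rw [Tm.vsubst_weaken, Tm.vsubst_var]

theorem Val.inst_weaken {s s' : Pol} (t : Val K [] s) (V : Val K [] s') :
    t.weaken.vsubst (Var.cons (F := Val K []) V (fun _ x => .var x)) = t := by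
  rw [Val.vsubst_weaken, Val.vsubst_var]

theorem Cmd.inst_cut_shift_weaken {s : Pol} (V : Val K [] s) (W : Tm K [] .neg) :
    (Cmd.cut (.val (.shift (.var .zero))) W.weaken).inst V = .cut (.val (.shift V)) W := by
  simp [Cmd.inst, Cmd.vsubst, Tm.vsubst, Val.vsubst, Tm.inst_weaken, Var.cons]

theorem Cmd.inst_cut_pair_weaken_left {s s' : Pol} (V : Val K [] s) (V' : Val K [] s')
    (W : Tm K [] .neg) :
    (Cmd.cut (.val (.pair (.var .zero) V'.weaken)) W.weaken).inst V =
      .cut (.val (.pair V V')) W := by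
  simp [Cmd.inst, Cmd.vsubst, Tm.vsubst, Val.vsubst, Tm.inst_weaken, Val.inst_weaken, Var.cons]

theorem Cmd.inst_cut_pair_weaken_right {s s' : Pol} (V : Val K [] s) (V' : Val K [] s')
    (W : Tm K [] .neg) :
    (Cmd.cut (.val (.pair V.weaken (.var .zero))) W.weaken).inst V' =
      .cut (.val (.pair V V')) W := by
  simp [Cmd.inst, Cmd.vsubst, Tm.vsubst, Val.vsubst, Tm.inst_weaken, Val.inst_weaken, Var.cons]

theorem Tm.weaken_vsubst_liftSub {s s' s'' : Pol} (t : Tm K [] s) (V : Val K [] s') :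
    (t.weaken.weaken (s' := s'')).vsubst
      (Val.liftSub (Var.cons (F := Val K []) V (fun _ x => .var x))) = t.weaken := by
  rw [Tm.vsubst_liftSub_weaken, Tm.inst_weaken]

/-- The command to which the evaluated one-tuple of `t` against `W` reduces. -/
def Cmd.letShift {s : Pol} (t : Tm K [] s) (W : Val K [] .neg) : Cmd K [] :=
  .bind t (.cut (.val (.shift (.var .zero))) (Tm.val W).weaken)

/-- The command to which the evaluated pair of `t` and `u` against `W` reduces. -/
def Cmd.letPair {s s' : Pol} (t : Tm K [] s) (u : Tm K [] s') (W : Val K [] .neg) : Cmd K [] :=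
  .bind t (.bind u.weaken
    (.cut (.val (.pair (.var (.succ .zero)) (.var .zero))) (Tm.val W).weaken.weaken))

theorem MuStep.letShift {s : Pol} (t : Tm K [] s) (W : Val K [] .neg) :
    MuStep (.cut t.letShift (.val W)) (.letShift t W) := by
  have h := MuStep.pos (Cmd.bind t.weaken
    (.cut (.val (.shift (.var .zero))) (.val (.var (.succ .zero))))) W
  rwa [Cmd.inst, Cmd.vsubst_bind, Tm.inst_weaken] at h

theorem MuStep.letPair {s s' : Pol} (t : Tm K [] s) (u : Tm K [] s') (W : Val K [] .neg) :
    MuStep (.cut (t.letPair u) (.val W)) (.letPair t u W) := by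
  have h := MuStep.pos (Cmd.bind t.weaken (.bind u.weaken.weaken
    (.cut (.val (.pair (.var (.succ .zero)) (.var .zero)))
      (.val (.var (.succ (.succ .zero))))))) W
  rwa [Cmd.inst, Cmd.vsubst_bind, Tm.inst_weaken, Cmd.vsubst_bind,
    Tm.weaken_vsubst_liftSub] at h

theorem Passes.shift (h_anti : ∀ c c' : NegCmd K, Step c c' → c' ∈ bot → c ∈ bot)
    (h_mu : ∀ (c c' : Cmd K []) (n : ℕ), MuStep c c' → c.count n ∈ bot → c'.count n ∈ bot)
    {ρ : Valuation D} {p : ℕ} {s : Pol} {t : Tm K [] s} {A : Mal s} (ht : Passes ρ p t A.perp) :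
    Passes ρ p t.shift A.down.perp := by
  intro r W hW n hn
  have h : Mal.perp (s := .neg) A.down.perp = A.down := eq_of_heq A.down.perp_perp
  rw [mem_starSet_neg, h] at hW
  have hc : ∀ p', ∀ V ∈ starSet ρ A p', ∀ n, p' + r ≤ n →
      ((Cmd.cut (.val (.shift (.var .zero))) (Tm.val W).weaken).inst V).count n ∈ bot := by
    intro p' V hV n hn
    rw [Cmd.inst_cut_shift_weaken]
    exact hW p' _ ((mem_starSet_down ρ A p' _).2 ⟨V, hV, rfl⟩) n (by omega)
  cases t with
  | val V =>
    have := count_inst_mem h_anti h_mu ht hc hn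
    rwa [Cmd.inst_cut_shift_weaken] at this
  | mu c => exact h_anti _ _ (.mu n (.letShift (.mu c) W)) (count_bind_mem h_anti ht hc hn)

theorem Passes.pair (h_anti : ∀ c c' : NegCmd K, Step c c' → c' ∈ bot → c ∈ bot)
    (h_mu : ∀ (c c' : Cmd K []) (n : ℕ), MuStep c c' → c.count n ∈ bot → c'.count n ∈ bot)
    {ρ : Valuation D} {p q : ℕ} {s s' : Pol} {t : Tm K [] s} {u : Tm K [] s'} {A : Mal s}
    {B : Mal s'} (ht : Passes ρ p t A.perp) (hu : Passes ρ q u B.perp) :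
    Passes ρ (p + q) (t.pair u) (A.tensor B).perp := by
  intro r W hW n hn
  have h : Mal.perp (s := .neg) (A.tensor B).perp = A.tensor B :=
    eq_of_heq (A.tensor B).perp_perp
  rw [mem_starSet_neg, h] at hW
  have hc : ∀ p', ∀ V ∈ starSet ρ A p', ∀ q', ∀ V' ∈ starSet ρ B q', ∀ n, q' + (p' + r) ≤ n →
      ((Cmd.cut (.val (.pair V.weaken (.var .zero))) (Tm.val W).weaken).inst V').count n ∈ bot := by
    intro p' V hV q' V' hV' n hn
    rw [Cmd.inst_cut_pair_weaken_right]
    exact hW (p' + q') _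
      ((mem_starSet_tensor ρ A B _ _).2 ⟨p', q', rfl, V, hV, V', hV', rfl⟩) n (by omega)
  have hlet : (Cmd.letPair t u W).count n ∈ bot := by
    refine count_bind_mem h_anti (r := q + r) ht (fun p' V hV m hm => ?_)
      (show p + (q + r) ≤ n by omega)
    have := count_bind_mem h_anti hu (hc p' V hV) (n := m) (by omega)
    rw [Cmd.inst, Cmd.vsubst_bind, Tm.inst_weaken]
    simp only [Cmd.vsubst, Tm.weaken_vsubst_liftSub]
    exact this
  cases t with
  | val V =>
    cases u with
    | val V' =>
      have := count_inst_mem h_anti h_mu ht (r := q + r) (n := n)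
        (c := Cmd.cut (.val (.pair (.var .zero) V'.weaken)) (Tm.val W).weaken)
        (fun p' V hV m hm => by
          have := count_inst_mem h_anti h_mu hu (hc p' V hV) (n := m) (by omega)
          rw [Cmd.inst_cut_pair_weaken_right] at this
          rwa [Cmd.inst_cut_pair_weaken_left]) (by omega)
      rwa [Cmd.inst_cut_pair_weaken_left] at this
    | mu c => exact h_anti _ _ (.mu n (.letPair (.val V) (.mu c) W)) hlet
  | mu c =>
    cases u with
    | val V' => exact h_anti _ _ (.mu n (.letPair (.mu c) (.val V') W)) hlet
    | mu c' => exact h_anti _ _ (.mu n (.letPair (.mu c) (.mu c') W)) hlet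

/-- The substitution `f` realizes the context `Γ` at the conditions `q`. -/
def PassesCtx (ρ : Valuation D) {Δ : List Pol} (q : ∀ s, Var Δ s → ℕ)
    (f : ∀ s, Var Δ s → Tm K [] s) (Γ : Ctx Δ) : Prop :=
  ∀ s (x : Var Δ s) (B : Mal s.flip), Γ s x = some B → Passes ρ (q s x) (f s x) B

theorem PassesCtx.cons {ρ : Valuation D} {Δ : List Pol} {q : ∀ s, Var Δ s → ℕ}
    {f : ∀ s, Var Δ s → Tm K [] s} {Γ : Ctx Δ} (h : PassesCtx ρ q f Γ) {s : Pol} {p : ℕ}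
    {t : Tm K [] s} {A : Mal s.flip} (ht : Passes ρ p t A) :
    PassesCtx ρ (Var.cons (F := fun _ => ℕ) p q) (Var.cons (F := Tm K []) t f)
      (Ctx.cons A Γ) := by
  intro s' x B hB
  cases x with
  | zero => cases hB; exact ht
  | succ x => exact h _ x B hB

theorem Var.sum_cons {Δ : List Pol} {s : Pol} (p : ℕ) (q : ∀ s, Var Δ s → ℕ) :
    Var.sum (Var.cons (s := s) (F := fun _ => ℕ) p q) = p + Var.sum q := rfl

theorem PassesCtx.split {ρ : Valuation D} {Δ : List Pol} {q : ∀ s, Var Δ s → ℕ}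
    {f : ∀ s, Var Δ s → Tm K [] s} {Γ Γ₁ Γ₂ : Ctx Δ} (h : PassesCtx ρ q f Γ)
    (hΓ : Γ.Split Γ₁ Γ₂) : ∃ q₁ q₂ : ∀ s, Var Δ s → ℕ, Var.sum q₁ + Var.sum q₂ ≤ Var.sum q ∧
      PassesCtx ρ q₁ f Γ₁ ∧ PassesCtx ρ q₂ f Γ₂ := by
  classical
  refine ⟨fun s x => if Γ₂ s x = none then q s x else 0,
    fun s x => if Γ₂ s x = none then 0 else q s x, Var.sum_add_sum_le fun s x => ?_, ?_, ?_⟩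
  · split_ifs <;> omega
  · intro s x B hB
    rcases hΓ s x with ⟨h₁, h₂⟩ | ⟨h₁, h₂⟩
    · simpa [h₂] using h s x B (h₁ ▸ hB)
    · rw [h₁] at hB; cases hB
  · intro s x B hB
    rcases hΓ s x with ⟨h₁, h₂⟩ | ⟨h₁, h₂⟩
    · rw [h₂] at hB; cases hB
    · simpa [hB] using h s x B (h₂ ▸ hB)

theorem PassesCtx.of_isInsert {ρ : Valuation D} {Δ : List Pol} {q : ∀ s, Var Δ s → ℕ}
    {f : ∀ s, Var Δ s → Tm K [] s} {Γ Γ' : Ctx Δ} (h : PassesCtx ρ q f Γ') {s : Pol}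
    {x : Var Δ s} {A : Mal s.flip} (hΓ : Γ'.IsInsert Γ x A) : PassesCtx ρ q f Γ := by
  intro s' y B hB
  by_cases hy : s' = s ∧ y ≍ x
  · obtain ⟨rfl, hy⟩ := hy
    cases hy
    rw [hΓ.1] at hB; cases hB
  · exact h s' y B ((hΓ.2.2 s' y hy).trans hB)

mutual

theorem DTm.passes (h_anti : ∀ c c' : NegCmd K, Step c c' → c' ∈ bot → c ∈ bot)
    (h_mu : ∀ (c c' : Cmd K []) (n : ℕ), MuStep c c' → c.count n ∈ bot → c'.count n ∈ bot)
    (ρ : Valuation D) : ∀ {Δ : List Pol} {Γ : Ctx Δ} {s : Pol} {t : Tm K Δ s} {A : Mal s}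
    (d : DTm Γ t A) (q : ∀ s, Var Δ s → ℕ) (f : ∀ s, Var Δ s → Tm K [] s),
    PassesCtx ρ q f Γ → Passes ρ (d.cost + Var.sum q) (t.subst f) A.perp
  | _, _, _, _, _, .ax x A hΓ, q, f, h => by
    simp only [Tm.subst, Val.subst, DTm.cost]
    have := Var.le_sum q x
    exact (h _ x _ hΓ.1).mono (by omega)
  | _, _, _, _, _, .muPos (P := P) d, q, f, h => fun r W hW n hn => by
    have hP : Mal.perp (s := .neg) P.perp = P := eq_of_heq P.perp_perp
    rw [mem_starSet_neg, hP] at hW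
    simp only [DTm.cost] at hn
    refine h_anti _ _ (.mu n (.pos _ W)) ?_
    rw [Cmd.inst_subst_liftSub]
    refine d.passes h_anti h_mu ρ _ _ (h.cons (s := .neg) hW) n ?_
    rw [Var.sum_cons]
    omega
  | _, _, _, _, _, .muNeg (N := N) d, q, f, h => fun r V hV n hn => by
    simp only [DTm.cost] at hn
    refine h_anti _ _ (.mu n (.neg V _)) ?_
    rw [Cmd.inst_subst_liftSub]
    refine d.passes h_anti h_mu ρ _ _
      (h.cons (s := .pos) (passes_of_mem_dualStarSet ρ (s := .pos) N r V hV)) n ?_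
    rw [Var.sum_cons]
    omega
  | _, _, _, _, _, .tensor d₁ d₂ hΓ, q, f, h => by
    obtain ⟨q₁, q₂, hq, h₁, h₂⟩ := h.split hΓ
    refine ((d₁.passes h_anti h_mu ρ q₁ f h₁).pair h_anti h_mu
      (d₂.passes h_anti h_mu ρ q₂ f h₂)).mono ?_
    simp only [DTm.cost]
    omega
  | _, _, _, _, _, .par (A := A) (B := B) d, q, f, h => fun r X hX n hn => by
    obtain ⟨p₁, p₂, rfl, V, hV, V', hV', rfl⟩ := (mem_starSet_par_perp ρ A B r X).1 hX
    simp only [DTm.cost] at hn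
    obtain ⟨m, rfl⟩ : ∃ m, n = m + 1 := ⟨n - 1, by omega⟩
    refine h_anti _ _ (.beta m (.pair V V' _)) ?_
    rw [Cmd.inst₂_subst_liftSub]
    refine d.passes h_anti h_mu ρ _ _ ((h.cons (passes_of_mem_dualStarSet ρ B p₂ V' hV')).cons
      (passes_of_mem_dualStarSet ρ A p₁ V hV)) m ?_
    rw [Var.sum_cons, Var.sum_cons]
    omega
  | _, _, _, _, _, .down d, q, f, h => by
    simp only [DTm.cost]
    exact (d.passes h_anti h_mu ρ q f h).shift h_anti h_mu
  | _, _, _, _, _, .up (A := A) d, q, f, h => fun r X hX n hn => by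
    obtain ⟨V, hV, rfl⟩ := (mem_starSet_up_perp ρ A r X).1 hX
    simp only [DTm.cost] at hn
    obtain ⟨m, rfl⟩ : ∃ m, n = m + 1 := ⟨n - 1, by omega⟩
    refine h_anti _ _ (.beta m (.shift V _)) ?_
    rw [Cmd.inst_subst_liftSub]
    refine d.passes h_anti h_mu ρ _ _ (h.cons (passes_of_mem_dualStarSet ρ A r V hV)) m ?_
    rw [Var.sum_cons]
    omega

theorem DCmd.passes (h_anti : ∀ c c' : NegCmd K, Step c c' → c' ∈ bot → c ∈ bot)
    (h_mu : ∀ (c c' : Cmd K []) (n : ℕ), MuStep c c' → c.count n ∈ bot → c'.count n ∈ bot)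
    (ρ : Valuation D) : ∀ {Δ : List Pol} {Γ : Ctx Δ} {c : Cmd K Δ}
    (d : DCmd Γ c) (q : ∀ s, Var Δ s → ℕ) (f : ∀ s, Var Δ s → Tm K [] s),
    PassesCtx ρ q f Γ → ∀ n, d.cost + Var.sum q ≤ n → (c.subst f).count n ∈ bot
  | _, _, _, .cut (u := .val U) (P := P) d₁ d₂ hΓ, q, f, h, n, hn => by
    obtain ⟨q₁, q₂, hq, h₁, h₂⟩ := h.split hΓ
    have ht := d₁.passes h_anti h_mu ρ q₁ f h₁
    have hu := d₂.passes h_anti h_mu ρ q₂ f h₂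
    simp only [DCmd.cost] at hn
    simp only [Cmd.subst]
    generalize Tm.subst f (.val U) = u at hu ⊢
    obtain ⟨W⟩ := u
    exact ht _ W ((mem_starSet_neg ρ P.perp _ W).2 hu) n (by omega)
  | _, _, _, .weak x A d hΓ, q, f, h, n, hn => by
    simp only [DCmd.cost] at hn
    exact d.passes h_anti h_mu ρ q f (h.of_isInsert hΓ) n hn

end

end LinForcing

theorem mainTheorem7 {K : Pol → Type*} (bot : Set (NegCmd K))
    (h_anti : ∀ c c' : NegCmd K, Step c c' → c' ∈ bot → c ∈ bot)
    (h_mu : ∀ (c c' : Cmd K []) (n : ℕ), MuStep c c' → c.count n ∈ bot → c'.count n ∈ bot)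
    (D : PropDomain bot) (ρ : Valuation D)
    (Δ : List Pol) (B : ∀ s : Pol, Var Δ s → Mal s.flip)
    (s : Pol) (t : Tm K Δ s) (A : Mal s)
    (π : DTm (fun s' x => some (B s' x)) t A)
    (u : ∀ s' : Pol, Var Δ s' → Tm K [] s') (q : ∀ s' : Pol, Var Δ s' → ℕ)
    (hu : ∀ (s' : Pol) (x : Var Δ s'),
      Realizes ρ (u s' x) (forces (.numeral (q s' x)) (B s' x).perp)) :
    Realizes ρ (t.subst u) (forces (sumCond (.numeral π.cost) Δ q) A) := by
  rw [realizes_forces, Con.eval_sumCond, Con.eval_numeral]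
  refine π.passes h_anti h_mu ρ q u fun s' x B' hB' => ?_
  cases hB'
  have := (realizes_forces_perp ρ _ _ _).1 (hu s' x)
  rwa [Con.eval_numeral] at this
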